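/- **Setting.** For integers $n,d,k\ge 1$, an instance of *full chromatic $k$-means* consists of $n$ point-sets $G_1,\dots,G_n$, each with exactly $k$ points in $\mathbb{R}^d$. A *chromatic partition* is a partition of the $nk$ points into $k$ sets $U_1,\dots,U_k$ such that each $U_j$ contains at most one point of each $G_i$. A feasible solution consists of $k$ centers $m_1,\dots,m_k\in\mathbb{R}^d$ and a chromatic partition $U_1,\dots,U_k$; its cost is $\frac1n\sum_{j=1}^{k}\sum_{q\in U_j}\|q-m_j\|^2$ (Euclidean norm). A $(1+\epsilon)$-approximation is a feasible solution whose cost is at most $(1+\epsilon)$ times the cost of every feasible solution. **Model of computation.** A randomized real RAM: exact real arithmetic ($+,-,\times,\div$), comparisons, addition and (truncated) subtraction of natural numbers, indirect addressing, and drawing a uniformly random element of $\{0,\dots,m-1\}$ each take unit time; programs contain no real constants, and reals cannot be rounded to integers. **Theorem.** There are one randomized real RAM program $A$, constants $c>0$ and $C>0$, and a polynomial $p$ such that the following holds for all integers $n,d,k\ge 1$, all $\epsilon\in(0,1]$ and all instances $\mathcal G=\{G_1,\dots,G_n\}$ of full chromatic $k$-means in $\mathbb{R}^d$. On input $n,d,k,\epsilon$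 and the coordinates of the points of $\mathcal G$, every run of $A$ halts within time $C\cdot 2^{p(k/\epsilon)}\cdot n\cdot d$, and with probability at least $c$ its output (the $k$ centers and the cluster index of each point) is a $(1+\epsilon)$-approximation. -/

import Mathlib

noncomputable section

/-! ## Chromatic k-means clustering -/

namespace ChromaticClustering

/-- A family of `n` point-sets in `ℝ^d`; the `i`-th one consists of the `K i` points `G i l`. -/
abbrev PointSets (d : ℕ) {n : ℕ} (K : Fin n → ℕ) : Type :=
  (i : Fin n) → Fin (K i) → EuclideanSpace ℝ (Fin d)

/-- `U` is a chromatic partition: every point (a pair `⟨i, l⟩`) lies in exactly one of the `k` sets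
`U j`, and every `U j` contains at most one point of each point-set `i`. -/
def IsChromaticPartition {n k : ℕ} {K : Fin n → ℕ}
    (U : Fin k → Finset (Σ i : Fin n, Fin (K i))) : Prop :=
  (∀ q, ∃! j, q ∈ U j) ∧ ∀ j, ∀ q ∈ U j, ∀ q' ∈ U j, q.1 = q'.1 → q = q'

/-- The objective `(1/n) ∑_j ∑_{q ∈ U_j} ‖q - m_j‖²`. -/
def cost {n d k : ℕ} {K : Fin n → ℕ} (G : PointSets d K)
    (m : Fin k → EuclideanSpace ℝ (Fin d)) (U : Fin k → Finset (Σ i : Fin n, Fin (K i))) : ℝ :=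
  (1 / (n : ℝ)) * ∑ j, ∑ q ∈ U j, ‖G q.1 q.2 - m j‖ ^ 2

/-- `(m, U)` is a feasible solution of chromatic `k`-means on `G` whose objective value is at most
`r` times the objective value of every feasible solution (equivalently, of an optimal one). -/
def IsApproximation {n d k : ℕ} {K : Fin n → ℕ} (r : ℝ) (G : PointSets d K)
    (m : Fin k → EuclideanSpace ℝ (Fin d)) (U : Fin k → Finset (Σ i : Fin n, Fin (K i))) : Prop :=
  IsChromaticPartition U ∧
    ∀ (m' : Fin k → EuclideanSpace ℝ (Fin d)) (U' : Fin k → Finset (Σ i : Fin n, Fin (K i))),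
      IsChromaticPartition U' → cost G m U ≤ r * cost G m' U'

/-- The full problem: all point-sets have exactly `k` points. -/
abbrev FullPointSets (n d k : ℕ) : Type := PointSets d (fun _ : Fin n => k)

end ChromaticClustering

/-! ## Randomized real RAM

Programs are written in a structured language over a memory consisting of arrays of natural
numbers and arrays of reals. An array is selected by a fixed number in the program, a cell by a
computed index (indirect addressing). A program contains no real constants, natural numbers can
only be added, subtracted and compared, and no operation turns a real into a natural number. -/

namespace RealRAM

/-- `nat a i` and `real a i` are the `i`-th cells of the `a`-th arrays. -/
structure Memory where
  nat : ℕ → ℕ → ℕ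
  real : ℕ → ℕ → ℝ

/-- Store `v` into cell `i` of the natural-number array `a`. -/
def Memory.setNat (s : Memory) (a i v : ℕ) : Memory :=
  { s with nat := Function.update s.nat a (Function.update (s.nat a) i v) }

/-- Store `v` into cell `i` of the real array `a`. -/
def Memory.setReal (s : Memory) (a i : ℕ) (v : ℝ) : Memory :=
  { s with real := Function.update s.real a (Function.update (s.real a) i v) }

/-- Natural-number expressions; `get a i` reads cell `i` of the natural-number array `a`. -/
inductive NExpr where
  | lit (c : ℕ)
  | get (a : ℕ) (i : NExpr)
  | plus (e f : NExpr)
  | minus (e f : NExpr)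

/-- Subtraction of natural numbers is truncated at `0`. -/
def NExpr.eval (s : Memory) : NExpr → ℕ
  | lit c => c
  | get a i => s.nat a (i.eval s)
  | plus e f => e.eval s + f.eval s
  | minus e f => e.eval s - f.eval s

/-- Number of operations. -/
def NExpr.size : NExpr → ℕ
  | lit _ => 1
  | get _ i => i.size + 1
  | plus e f => e.size + f.size + 1
  | minus e f => e.size + f.size + 1

/-- Real expressions; `get a i` reads cell `i` of the real array `a`. -/
inductive RExpr where
  | ofNat (e : NExpr)
  | get (a : ℕ) (i : NExpr)
  | plus (e f : RExpr)
  | minus (e f : RExpr)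
  | times (e f : RExpr)
  | quot (e f : RExpr)

/-- Exact real arithmetic; division by zero returns `0`. -/
def RExpr.eval (s : Memory) : RExpr → ℝ
  | ofNat e => (e.eval s : ℝ)
  | get a i => s.real a (i.eval s)
  | plus e f => e.eval s + f.eval s
  | minus e f => e.eval s - f.eval s
  | times e f => e.eval s * f.eval s
  | quot e f => e.eval s / f.eval s

/-- Number of operations. -/
def RExpr.size : RExpr → ℕ
  | ofNat e => e.size + 1
  | get _ i => i.size + 1
  | plus e f => e.size + f.size + 1
  | minus e f => e.size + f.size + 1
  | times e f => e.size + f.size + 1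
  | quot e f => e.size + f.size + 1

/-- Tests. -/
inductive Test where
  | natLe (e f : NExpr)
  | realLe (e f : RExpr)
  | neg (b : Test)
  | both (b c : Test)

/-- The truth value of a test. -/
def Test.eval (s : Memory) : Test → Prop
  | natLe e f => e.eval s ≤ f.eval s
  | realLe e f => e.eval s ≤ f.eval s
  | neg b => ¬ b.eval s
  | both b c => b.eval s ∧ c.eval s

/-- Number of operations. -/
def Test.size : Test → ℕ
  | natLe e f => e.size + f.size + 1
  | realLe e f => e.size + f.size + 1
  | neg b => b.size + 1
  | both b c => b.size + c.size + 1

/-- Programs. `rand a i m` stores into cell `i` of the natural-number array `a` a uniformly random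
element of `{0, …, m - 1}`, independent of everything before; `loop b p` is "while `b` do `p`". -/
inductive Program where
  | skip
  | setNat (a : ℕ) (i e : NExpr)
  | setReal (a : ℕ) (i : NExpr) (e : RExpr)
  | rand (a : ℕ) (i m : NExpr)
  | seq (p q : Program)
  | ite (b : Test) (p q : Program)
  | loop (b : Test) (p : Program)

/-- The uniform distribution on `{0, …, m - 1}` (and the value `0` if `m = 0`). -/
def uniformBelow : ℕ → PMF ℕ
  | 0 => PMF.pure 0
  | m + 1 => (PMF.uniformOfFintype (Fin (m + 1))).map Fin.val

/-- A configuration: the program parts still to be executed, in order, the memory, and the time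
spent so far. -/
structure Configuration where
  todo : List Program
  mem : Memory
  time : ℕ

open Classical in
/-- One step. Executing a command costs one time unit, plus one for every operation of the
expressions and tests that it evaluates. A configuration with nothing left to do has halted. -/
def step : Configuration → PMF Configuration
  | ⟨[], s, t⟩ => PMF.pure ⟨[], s, t⟩
  | ⟨.skip :: r, s, t⟩ => PMF.pure ⟨r, s, t + 1⟩
  | ⟨.setNat a i e :: r, s, t⟩ =>
      PMF.pure ⟨r, s.setNat a (i.eval s) (e.eval s), t + (i.size + e.size + 1)⟩
  | ⟨.setReal a i e :: r, s, t⟩ =>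
      PMF.pure ⟨r, s.setReal a (i.eval s) (e.eval s), t + (i.size + e.size + 1)⟩
  | ⟨.rand a i m :: r, s, t⟩ =>
      (uniformBelow (m.eval s)).map
        fun v => ⟨r, s.setNat a (i.eval s) v, t + (i.size + m.size + 1)⟩
  | ⟨.seq p q :: r, s, t⟩ => PMF.pure ⟨p :: q :: r, s, t + 1⟩
  | ⟨.ite b p q :: r, s, t⟩ =>
      PMF.pure ⟨(if b.eval s then p else q) :: r, s, t + (b.size + 1)⟩
  | ⟨.loop b p :: r, s, t⟩ =>
      PMF.pure ⟨if b.eval s then p :: .loop b p :: r else r, s, t + (b.size + 1)⟩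

/-- The distribution of the configuration after `N` steps. -/
def steps : ℕ → Configuration → PMF Configuration
  | 0, x => PMF.pure x
  | N + 1, x => (step x).bind (steps N)

/-- The distribution of the configuration that `A` reaches from the memory `s` in `T` steps. As
every step before halting costs at least one time unit, each run of `A` that halts within time `T`
has halted after `T` steps. -/
def run (A : Program) (s : Memory) (T : ℕ) : PMF Configuration :=
  steps T ⟨[A], s, 0⟩

/-- Every run of `A` from the memory `s` halts within time `T`. -/
def HaltsWithin (A : Program) (s : Memory) (T : ℕ) : Prop :=
  ∀ x ∈ (run A s T).support, x.todo = [] ∧ x.time ≤ T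

end RealRAM

/-! ## Input and output of programs for full chromatic k-means -/

namespace ChromaticClustering

open RealRAM

/-- The input: natural-number array `0` holds `n, d, k`, real array `0` holds `ε`, real array `1`
holds the `n * k * d` coordinates of the points, coordinate `j` of the point `G i l` in cell
`(i * k + l) * d + j`. All other cells are `0`. -/
def inputMemory {n d k : ℕ} (ε : ℝ) (G : FullPointSets n d k) : Memory where
  nat a i :=
    if a = 0 then (if i = 0 then n else if i = 1 then d else if i = 2 then k else 0) else 0
  real a i :=
    if a = 0 then (if i = 0 then ε else 0)
    else if a = 1 then
      if h : i < n * k * d then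
        let x : Fin (n * k) × Fin d := finProdFinEquiv.symm ⟨i, h⟩
        let y : Fin n × Fin k := finProdFinEquiv.symm x.1
        G y.1 y.2 x.2
      else 0
    else 0

/-- The output centers: coordinate `i` of the center `j` is in cell `j * d + i` of the real
array `2`. -/
def outputCenters (d k : ℕ) (s : Memory) : Fin k → EuclideanSpace ℝ (Fin d) :=
  fun j => WithLp.toLp 2 fun i => s.real 2 ((j : ℕ) * d + (i : ℕ))

/-- The output clusters: the index of the cluster of the point `⟨i, l⟩` is in cell `i * k + l` of
the natural-number array `1`. -/
def outputClusters (n k : ℕ) (s : Memory) : Fin k → Finset (Σ _ : Fin n, Fin k) :=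
  fun j => Finset.univ.filter fun q => s.nat 1 ((q.1 : ℕ) * k + (q.2 : ℕ)) = (j : ℕ)

end ChromaticClustering

end

/-!
In a full instance every cluster of a chromatic partition contains exactly one point of each
point-set, so a chromatic partition is a family of permutations `σ i` of `{0, …, k - 1}`, and every
cluster has exactly `n` of the `n * k` points. A uniformly random point therefore lies in a given
optimal cluster with probability `1 / k`, however the points are arranged.

The algorithm makes `R = 2 ^ (k * k * m)` trials with `m = ⌈2 / ε⌉`. A trial draws `m` random points
for each of the `k` clusters and takes their means as centers. With probability `k ^ (-m * k)` all
of them come from the right clusters, and then the excess of the cost over the optimum has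
expectation `1 / m ≤ ε / 2` times the optimum (`sum_norm_mean_sample_sub_sq`); by Markov's inequality
it is at most `ε` times the optimum with probability at least `1 / 2` (`card_le_mul_card_good`). As
`k ^ (m * k) ≤ R`, a trial is good with probability at least `1 / (2 * R)`, and some trial is good
with probability at least `1 / 3` (`card_le_three_mul_card_exists`). For given centers, an optimal
chromatic partition is found separately for each point-set by running through all numbers below
`R`, which is at least `k ^ k`, as codes of functions from `{0, …, k - 1}` to itself. The best
solution of all trials is put out; it is at least as good as that of any good trial
(`isApproximation_of_isBestTrial`). The running time is linear in `n` and in `d` and polynomial in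
`R` (`time_le`).

All random numbers are drawn before the trials start, into an array that serves as a random tape.
The part before and the part after the drawing are deterministic and are verified with the rules for
`RealRAM.Ends`, a total-correctness assertion with a time bound and with the frame property that
arrays which the program does not write to are unchanged. The drawing loop takes the same number of
steps in every run (`RealRAM.steps_forLoop_rand`), so the outcome of the whole run is the image of
the uniform distribution on tapes (`exists_run_mainProg`), and probabilities become cardinalities.
-/

namespace RealRAM

/-! ### Deterministic runs -/

theorem steps_succ (N : ℕ) (x : Configuration) : steps (N + 1) x = (step x).bind (steps N) := rfl

theorem steps_halted (N : ℕ) (s : Memory) (t : ℕ) : steps N ⟨[], s, t⟩ = PMF.pure ⟨[], s, t⟩ := by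
  induction N with
  | zero => rfl
  | succ N ih => rw [steps_succ, step, PMF.pure_bind, ih]

/-- A sufficient syntactic condition for `p` to leave the natural-number array `a` unchanged. -/
def Program.keepsNat (a : ℕ) : Program → Bool
  | .skip => true
  | .setNat b _ _ => a != b
  | .setReal _ _ _ => true
  | .rand b _ _ => a != b
  | .seq p q => p.keepsNat a && q.keepsNat a
  | .ite _ p q => p.keepsNat a && q.keepsNat a
  | .loop _ p => p.keepsNat a

/-- A sufficient syntactic condition for `p` to leave the real array `a` unchanged. -/
def Program.keepsReal (a : ℕ) : Program → Bool
  | .skip => true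
  | .setNat _ _ _ => true
  | .setReal b _ _ => a != b
  | .rand _ _ _ => true
  | .seq p q => p.keepsReal a && q.keepsReal a
  | .ite _ p q => p.keepsReal a && q.keepsReal a
  | .loop _ p => p.keepsReal a

/-- The memories `s` and `s'` differ only in arrays that `p` writes to. -/
structure Same (p : Program) (s s' : Memory) : Prop where
  nat : ∀ a, p.keepsNat a = true → s'.nat a = s.nat a
  real : ∀ a, p.keepsReal a = true → s'.real a = s.real a

theorem Same.refl (p : Program) (s : Memory) : Same p s s := ⟨fun _ _ => rfl, fun _ _ => rfl⟩

theorem Same.trans {p : Program} {s s' s'' : Memory} (h : Same p s s') (h' : Same p s' s'') :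
    Same p s s'' :=
  ⟨fun a ha => (h'.nat a ha).trans (h.nat a ha), fun a ha => (h'.real a ha).trans (h.real a ha)⟩

theorem Same.of_keeps {p q : Program} {s s' : Memory} (h : Same p s s')
    (hn : ∀ a, q.keepsNat a = true → p.keepsNat a = true)
    (hr : ∀ a, q.keepsReal a = true → p.keepsReal a = true) : Same q s s' :=
  ⟨fun a ha => h.nat a (hn a ha), fun a ha => h.real a (hr a ha)⟩

@[simp] theorem Memory.setNat_real (s : Memory) (a i v : ℕ) : (s.setNat a i v).real = s.real := rfl

@[simp] theorem Memory.setReal_nat (s : Memory) (a i : ℕ) (v : ℝ) :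
    (s.setReal a i v).nat = s.nat := rfl

@[simp] theorem Memory.setNat_nat_same (s : Memory) (a i v : ℕ) :
    (s.setNat a i v).nat a = Function.update (s.nat a) i v := by simp [Memory.setNat]

@[simp] theorem Memory.setReal_real_same (s : Memory) (a i : ℕ) (v : ℝ) :
    (s.setReal a i v).real a = Function.update (s.real a) i v := by simp [Memory.setReal]

@[simp] theorem Memory.setNat_nat_ne (s : Memory) {a b : ℕ} (i v : ℕ) (h : b ≠ a) :
    (s.setNat a i v).nat b = s.nat b := by simp [Memory.setNat, h]

@[simp] theorem Memory.setReal_real_ne (s : Memory) {a b : ℕ} (i : ℕ) (v : ℝ) (h : b ≠ a) :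
    (s.setReal a i v).real b = s.real b := by simp [Memory.setReal, h]

/-- Started in the memory `s`, every run of the program `p` ends after at most `B` time units in one
and the same memory, which satisfies `Q` and differs from `s` only in arrays that `p` writes to. The
continuation `r`, the time `t₀` already spent and the number `M` of further steps are arbitrary, so
that such runs can be composed. -/
def Ends (p : Program) (s : Memory) (B : ℕ) (Q : Memory → Prop) : Prop :=
  ∃ s' N t, N ≤ t ∧ t ≤ B ∧ Same p s s' ∧ Q s' ∧
    ∀ r t₀ M, steps (N + M) ⟨p :: r, s, t₀⟩ = steps M ⟨r, s', t₀ + t⟩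

theorem Ends.mono {p : Program} {s : Memory} {B B' : ℕ} {Q Q' : Memory → Prop}
    (h : Ends p s B Q) (hB : B ≤ B') (hQ : ∀ s', Same p s s' → Q s' → Q' s') : Ends p s B' Q' := by
  obtain ⟨s', N, t, h1, h2, h3, h4, h5⟩ := h
  exact ⟨s', N, t, h1, h2.trans hB, h3, hQ s' h3 h4, h5⟩

theorem Ends.skip {s : Memory} {B : ℕ} {Q : Memory → Prop} (hB : 1 ≤ B) (hQ : Q s) :
    Ends .skip s B Q := by
  refine ⟨s, 1, 1, le_rfl, hB, Same.refl _ _, hQ, fun r t₀ M => ?_⟩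
  rw [Nat.add_comm, steps_succ, step, PMF.pure_bind]

theorem Ends.setNat {a : ℕ} {i e : NExpr} {s : Memory} {B : ℕ} {Q : Memory → Prop}
    (hB : i.size + e.size + 1 ≤ B) (hQ : Q (s.setNat a (i.eval s) (e.eval s))) :
    Ends (.setNat a i e) s B Q := by
  refine ⟨s.setNat a (i.eval s) (e.eval s), 1, _, by omega, hB,
    ⟨fun b hb => ?_, fun b _ => rfl⟩, hQ, fun r t₀ M => ?_⟩
  · simp only [Program.keepsNat, bne_iff_ne] at hb
    simp [hb]
  · rw [Nat.add_comm, steps_succ, step, PMF.pure_bind]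

theorem Ends.setReal {a : ℕ} {i : NExpr} {e : RExpr} {s : Memory} {B : ℕ} {Q : Memory → Prop}
    (hB : i.size + e.size + 1 ≤ B) (hQ : Q (s.setReal a (i.eval s) (e.eval s))) :
    Ends (.setReal a i e) s B Q := by
  refine ⟨s.setReal a (i.eval s) (e.eval s), 1, _, by omega, hB,
    ⟨fun b _ => rfl, fun b hb => ?_⟩, hQ, fun r t₀ M => ?_⟩
  · simp only [Program.keepsReal, bne_iff_ne] at hb
    simp [hb]
  · rw [Nat.add_comm, steps_succ, step, PMF.pure_bind]

theorem Ends.seq {p q : Program} {s : Memory} {B₁ B₂ B : ℕ} {Q₁ Q : Memory → Prop}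
    (h₁ : Ends p s B₁ Q₁) (h₂ : ∀ s₁, Same p s s₁ → Q₁ s₁ → Ends q s₁ B₂ Q)
    (hB : B₁ + B₂ + 1 ≤ B) : Ends (.seq p q) s B Q := by
  obtain ⟨s₁, N₁, t₁, a1, a2, a3, a4, a5⟩ := h₁
  obtain ⟨s₂, N₂, t₂, b1, b2, b3, b4, b5⟩ := h₂ s₁ a3 a4
  refine ⟨s₂, 1 + N₁ + N₂, 1 + t₁ + t₂, by omega, by omega, ?_, b4, fun r t₀ M => ?_⟩
  · refine (a3.of_keeps ?_ ?_).trans (b3.of_keeps ?_ ?_) <;> intro a ha <;>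
      simp [Program.keepsNat, Program.keepsReal] at ha <;> simp [ha]
  · rw [show 1 + N₁ + N₂ + M = (N₁ + (N₂ + M)) + 1 by omega, steps_succ, step, PMF.pure_bind, a5, b5,
      show t₀ + 1 + t₁ + t₂ = t₀ + (1 + t₁ + t₂) by omega]

theorem Ends.ite {b : Test} {p q : Program} {s : Memory} {B₁ B : ℕ} {Q : Memory → Prop}
    (h₁ : b.eval s → Ends p s B₁ Q) (h₂ : ¬ b.eval s → Ends q s B₁ Q)
    (hB : B₁ + b.size + 1 ≤ B) : Ends (.ite b p q) s B Q := by
  by_cases hb : b.eval s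
  · obtain ⟨s₁, N₁, t₁, a1, a2, a3, a4, a5⟩ := h₁ hb
    refine ⟨s₁, N₁ + 1, t₁ + (b.size + 1), by omega, by omega, ?_, a4, fun r t₀ M => ?_⟩
    · refine a3.of_keeps ?_ ?_ <;> intro a ha <;>
        simp [Program.keepsNat, Program.keepsReal] at ha <;> simp [ha]
    · rw [Nat.add_right_comm, steps_succ, step, PMF.pure_bind, if_pos hb, a5,
        show t₀ + (b.size + 1) + t₁ = t₀ + (t₁ + (b.size + 1)) by omega]
  · obtain ⟨s₁, N₁, t₁, a1, a2, a3, a4, a5⟩ := h₂ hb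
    refine ⟨s₁, N₁ + 1, t₁ + (b.size + 1), by omega, by omega, ?_, a4, fun r t₀ M => ?_⟩
    · refine a3.of_keeps ?_ ?_ <;> intro a ha <;>
        simp [Program.keepsNat, Program.keepsReal] at ha <;> simp [ha]
    · rw [Nat.add_right_comm, steps_succ, step, PMF.pure_bind, if_neg hb, a5,
        show t₀ + (b.size + 1) + t₁ = t₀ + (t₁ + (b.size + 1)) by omega]

/-- Total correctness of a loop that is executed exactly `L` times, with an invariant `I` indexed
by the number of executions so far. -/
theorem Ends.loop {b : Test} {p : Program} {s : Memory} {L B₁ B : ℕ} {Q : Memory → Prop}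
    (I : ℕ → Memory → Prop) (h0 : I 0 s)
    (hstep : ∀ i < L, ∀ s', Same p s s' → I i s' → b.eval s' ∧ Ends p s' B₁ (I (i + 1)))
    (hend : ∀ s', Same p s s' → I L s' → ¬ b.eval s' ∧ Q s')
    (hB : L * (B₁ + b.size + 1) + b.size + 1 ≤ B) : Ends (.loop b p) s B Q := by
  suffices H : ∀ j i s', i + j = L → Same p s s' → I i s' →
      ∃ s'' N t, N ≤ t ∧ t ≤ j * (B₁ + b.size + 1) + b.size + 1 ∧ Same p s s'' ∧ Q s'' ∧
        ∀ r t₀ M, steps (N + M) ⟨.loop b p :: r, s', t₀⟩ = steps M ⟨r, s'', t₀ + t⟩ by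
    obtain ⟨s'', N, t, h1, h2, h3, h4, h5⟩ := H L 0 s (by omega) (Same.refl _ _) h0
    exact ⟨s'', N, t, h1, h2.trans hB, h3.of_keeps (fun _ h => h) (fun _ h => h), h4, h5⟩
  intro j
  induction j with
  | zero =>
    intro i s' hi hs hI
    obtain rfl : i = L := by omega
    obtain ⟨hb, hQ⟩ := hend s' hs hI
    refine ⟨s', 1, b.size + 1, by omega, by omega, hs, hQ, fun r t₀ M => ?_⟩
    rw [Nat.add_comm, steps_succ, step, PMF.pure_bind, if_neg hb]
  | succ j ih =>
    intro i s' hi hs hI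
    obtain ⟨hb, s₁, N₁, t₁, a1, a2, a3, a4, a5⟩ := hstep i (by omega) s' hs hI
    obtain ⟨s₂, N₂, t₂, c1, c2, c3, c4, c5⟩ := ih (i + 1) s₁ (by omega) (hs.trans a3) a4
    refine ⟨s₂, 1 + N₁ + N₂, b.size + 1 + t₁ + t₂, by omega, ?_, c3, c4, fun r t₀ M => ?_⟩
    · rw [Nat.succ_mul]; omega
    · rw [show 1 + N₁ + N₂ + M = (N₁ + (N₂ + M)) + 1 by omega, steps_succ, step, PMF.pure_bind,
        if_pos hb, a5, c5, show t₀ + (b.size + 1) + t₁ + t₂ = t₀ + (b.size + 1 + t₁ + t₂) by omega]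

/-- Cell `0` of the natural-number array `a`, used as a variable. -/
abbrev NExpr.var (a : ℕ) : NExpr := .get a (.lit 0)

/-- The loop "for `v = 0, …, lim - 1` do `p`". -/
def forLoop (v : ℕ) (lim : NExpr) (p : Program) : Program :=
  .seq (.setNat v (.lit 0) (.lit 0))
    (.loop (.natLe (.plus (.var v) (.lit 1)) lim)
      (.seq p (.setNat v (.lit 0) (.plus (.var v) (.lit 1)))))

theorem keepsNat_forLoop {a v : ℕ} {lim : NExpr} {p : Program} :
    (forLoop v lim p).keepsNat a = true ↔ a ≠ v ∧ p.keepsNat a = true := by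
  simp [forLoop, Program.keepsNat]; tauto

theorem keepsReal_forLoop {a v : ℕ} {lim : NExpr} {p : Program} :
    (forLoop v lim p).keepsReal a = true ↔ p.keepsReal a = true := by
  simp [forLoop, Program.keepsReal]

/-- Total correctness of for-loops. The constant in the time bound is generous, which keeps bounds
for nested loops in product form. -/
theorem Ends.forLoop {v : ℕ} {lim : NExpr} {p : Program} {s : Memory} {L B₁ B : ℕ}
    {Q : Memory → Prop} (I : ℕ → Memory → Prop) (hv : p.keepsNat v = true)
    (hlim : ∀ s', Same (RealRAM.forLoop v lim p) s s' → lim.eval s' = L)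
    (h0 : I 0 (s.setNat v 0 0))
    (hstep : ∀ i < L, ∀ s', Same (RealRAM.forLoop v lim p) s s' → s'.nat v 0 = i → I i s' →
      Ends p s' B₁ (fun s'' => I (i + 1) (s''.setNat v 0 (i + 1))))
    (hQ : ∀ s', Same (RealRAM.forLoop v lim p) s s' → I L s' → Q s')
    (hsize : lim.size ≤ 10) (hL : 1 ≤ L) (hB₁ : 1 ≤ B₁) (hB : 50 * (L * B₁) ≤ B) :
    Ends (RealRAM.forLoop v lim p) s B Q := by
  have hset : Same (RealRAM.forLoop v lim p) s (s.setNat v 0 0) :=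
    ⟨fun a ha => by rw [keepsNat_forLoop] at ha; simp [ha.1], fun _ _ => rfl⟩
  have hbody : ∀ s', Same (Program.seq p (.setNat v (.lit 0) (.plus (.var v) (.lit 1))))
      (s.setNat v 0 0) s' → Same (RealRAM.forLoop v lim p) s s' := fun s' hs =>
    hset.trans (hs.of_keeps
      (fun a ha => by rw [keepsNat_forLoop] at ha; simp [Program.keepsNat, ha])
      (fun a ha => by rw [keepsReal_forLoop] at ha; simp [Program.keepsReal, ha]))
  refine Ends.seq (B₁ := 3) (B₂ := L * (B₁ + 7 + (4 + lim.size + 1) + 1) + (4 + lim.size + 1) + 1)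
    (Q₁ := fun s' => s' = s.setNat v 0 0) (Ends.setNat (by simp [NExpr.size]) rfl) ?_ ?_
  · rintro s₁ hs₁ rfl
    refine Ends.loop (L := L) (B₁ := B₁ + 7) (fun i s' => s'.nat v 0 = i ∧ I i s') ⟨by simp, h0⟩
      ?_ ?_ ?_
    · rintro i hi s' hs ⟨hvi, hI⟩
      have hs' := hbody s' hs
      refine ⟨by simp only [Test.eval, NExpr.eval, hvi, hlim s' hs']; omega, ?_⟩
      refine Ends.seq (B₂ := 6) (hstep i hi s' hs' hvi hI) ?_ le_rfl
      intro s₂ hs₂ hI₂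
      have : s₂.nat v 0 = i := by rw [hs₂.nat v hv, hvi]
      refine Ends.setNat (by simp [NExpr.size]) ?_
      simp only [NExpr.eval, this]
      exact ⟨by simp, hI₂⟩
    · rintro s' hs ⟨hvi, hI⟩
      have hs' := hbody s' hs
      exact ⟨by simp only [Test.eval, NExpr.eval, hvi, hlim s' hs']; omega, hQ s' hs' hI⟩
    · simp [Test.size, NExpr.size]
  · have h1 : L * (B₁ + 7 + (4 + lim.size + 1) + 1) ≤ L * (B₁ + 23) :=
      Nat.mul_le_mul_left _ (by omega)
    have h2 : L * (B₁ + 23) ≤ L * (B₁ * 24) := Nat.mul_le_mul_left _ (by omega)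
    have h3 : 1 ≤ L * B₁ := Nat.mul_pos hL hB₁
    have h4 : L * (B₁ * 24) = 24 * (L * B₁) := by ring
    omega

/-! ### The random tape -/

/-- The distribution of the array that arises from `w` when cells `0, …, N - 1` are overwritten with
independent uniformly random elements of `{0, …, M - 1}`. -/
noncomputable def tape (M : ℕ) (w : ℕ → ℕ) : ℕ → PMF (ℕ → ℕ)
  | 0 => PMF.pure w
  | N + 1 => (tape M w N).bind fun w' => (uniformBelow M).map fun x => Function.update w' N x

/-- The memory `s` with `w` in place of the natural-number array `a`. -/
def Memory.withNat (s : Memory) (a : ℕ) (w : ℕ → ℕ) : Memory :=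
  { s with nat := Function.update s.nat a w }

/-- Filling an array with random numbers takes a number of steps and a time that do not depend on
the outcome. -/
theorem steps_forLoop_rand {a v : ℕ} (hav : a ≠ v) {lim m : NExpr} {L M' : ℕ} (s : Memory)
    (hlim : ∀ w c, lim.eval ((s.setNat v 0 c).withNat a w) = L)
    (hm : ∀ w c, m.eval ((s.setNat v 0 c).withNat a w) = M') :
    ∀ r t₀ M, steps (4 * L + 3 + M) ⟨forLoop v lim (.rand a (.var v) m) :: r, s, t₀⟩ =
      (tape M' (s.nat a) L).bind fun w => steps M ⟨r, (s.setNat v 0 L).withNat a w,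
        t₀ + (L * (m.size + lim.size + 16) + lim.size + 10)⟩ := by
  intro r t₀ M
  set b : Test := .natLe (.plus (.var v) (.lit 1)) lim with hb
  set inc : Program := .setNat v (.lit 0) (.plus (.var v) (.lit 1)) with hinc
  set p : Program := .rand a (.var v) m with hp
  have hsz : b.size = lim.size + 5 := by simp [hb, Test.size, NExpr.size]; omega
  -- one pass through the loop
  have pass : ∀ j < L, ∀ w t M, steps (4 + M)
      ⟨.loop b (.seq p inc) :: r, (s.setNat v 0 j).withNat a w, t⟩ =
      (uniformBelow M').bind fun x => steps M ⟨.loop b (.seq p inc) :: r,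
        (s.setNat v 0 (j + 1)).withNat a (Function.update w j x), t + (m.size + lim.size + 16)⟩ := by
    intro j hj w t M
    have hvj : ((s.setNat v 0 j).withNat a w).nat v 0 = j := by
      simp [Memory.withNat, hav.symm]
    have hbt : b.eval ((s.setNat v 0 j).withNat a w) := by
      simp only [hb, Test.eval, NExpr.eval, hvj, hlim]; omega
    rw [show 4 + M = M + 1 + 1 + 1 + 1 by omega, steps_succ, step, PMF.pure_bind, if_pos hbt,
      steps_succ, step, PMF.pure_bind, steps_succ, hp, step, PMF.bind_map, hm]
    congr 1
    funext x
    simp only [Function.comp_apply]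
    rw [steps_succ, hinc, step, PMF.pure_bind]
    congr 1
    have hne := hav.symm
    have e1 : ((s.setNat v 0 j).withNat a w).setNat a j x =
        (s.setNat v 0 j).withNat a (Function.update w j x) := by
      simp [Memory.withNat, Memory.setNat]
    have e2 : ((s.setNat v 0 j).withNat a (Function.update w j x)).setNat v 0 (j + 1) =
        (s.setNat v 0 (j + 1)).withNat a (Function.update w j x) := by
      simp only [Memory.withNat, Memory.setNat, Function.update_of_ne hne, Function.update_self,
        Function.update_idem, Memory.mk.injEq, and_true]
      rw [Function.update_comm hav, Function.update_idem]
    have hvj' : ((s.setNat v 0 j).withNat a (Function.update w j x)).nat v 0 = j := by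
      simp [Memory.withNat, hne]
    simp only [NExpr.eval, hvj, e1, hvj', e2, NExpr.size, hsz]
    congr 1
    omega
  have all : ∀ j ≤ L, ∀ t M, steps (4 * j + M)
      ⟨.loop b (.seq p inc) :: r, s.setNat v 0 0, t⟩ =
      (tape M' (s.nat a) j).bind fun w => steps M ⟨.loop b (.seq p inc) :: r,
        (s.setNat v 0 j).withNat a w, t + j * (m.size + lim.size + 16)⟩ := by
    intro j
    induction j with
    | zero =>
      intro _ t M
      simp only [tape, PMF.pure_bind, Nat.mul_zero, Nat.zero_add, Nat.zero_mul, Nat.add_zero]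
      congr 2
      simp [Memory.withNat, Memory.setNat, hav]
    | succ j ih =>
      intro hj t M
      rw [show 4 * (j + 1) + M = 4 * j + (4 + M) by ring, ih (by omega), tape, PMF.bind_bind]
      congr 1
      funext w
      rw [pass j (by omega), PMF.bind_map]
      congr 1
      funext x
      simp only [Function.comp_apply]
      congr 2
      ring
  have hlast : ∀ w t M, steps (1 + M)
      ⟨.loop b (.seq p inc) :: r, (s.setNat v 0 L).withNat a w, t⟩ =
      steps M ⟨r, (s.setNat v 0 L).withNat a w, t + (lim.size + 6)⟩ := by
    intro w t M
    have hvj : ((s.setNat v 0 L).withNat a w).nat v 0 = L := by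
      simp [Memory.withNat, hav.symm]
    have hbt : ¬ b.eval ((s.setNat v 0 L).withNat a w) := by
      simp only [hb, Test.eval, NExpr.eval, hvj, hlim]; omega
    rw [Nat.add_comm, steps_succ, step, PMF.pure_bind, if_neg hbt, hsz]
  rw [show 4 * L + 3 + M = (4 * L + (1 + M)) + 1 + 1 by omega, forLoop, steps_succ, step,
    PMF.pure_bind, steps_succ, step, PMF.pure_bind]
  simp only [NExpr.eval, NExpr.size]
  rw [all L le_rfl]
  congr 1
  funext w
  rw [hlast]
  congr 2
  ring

/-! ### Sums, array filling and tables -/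

/-- The cell `0` of the real array `acc` receives the sum of the values of `e` for
`v = 0, …, lim - 1`. -/
def sumLoop (v : ℕ) (lim : NExpr) (acc : ℕ) (e : RExpr) : Program :=
  .seq (.setReal acc (.lit 0) (.ofNat (.lit 0)))
    (forLoop v lim (.setReal acc (.lit 0) (.plus (.get acc (.lit 0)) e)))

theorem Ends.sumLoop {v acc : ℕ} {lim : NExpr} {e : RExpr} {s : Memory} {L : ℕ} (f : ℕ → ℝ)
    (hlim : ∀ s', Same (RealRAM.sumLoop v lim acc e) s s' → lim.eval s' = L)
    (he : ∀ i < L, ∀ s', Same (RealRAM.sumLoop v lim acc e) s s' → s'.nat v 0 = i →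
      e.eval s' = f i)
    (hsize : lim.size ≤ 10) (hesize : e.size ≤ 50) (hL : 1 ≤ L) :
    Ends (RealRAM.sumLoop v lim acc e) s (3000 * L)
      (fun s' => s'.real acc 0 = ∑ i ∈ Finset.range L, f i) := by
  refine Ends.seq (B₁ := 4) (B₂ := 50 * (L * 55)) (Q₁ := fun s' => s'.real acc 0 = 0)
    (Ends.setReal (by simp [NExpr.size, RExpr.size]) (by simp [RExpr.eval, NExpr.eval])) ?_
    (by omega)
  intro s₁ h₁ hz
  have key : ∀ s', Same (RealRAM.forLoop v lim (.setReal acc (.lit 0)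
      (.plus (.get acc (.lit 0)) e))) s₁ s' → Same (RealRAM.sumLoop v lim acc e) s s' := by
    intro s' hs
    refine Same.trans (h₁.of_keeps ?_ ?_) (hs.of_keeps ?_ ?_) <;> intro a ha <;>
      simp_all [RealRAM.sumLoop, Program.keepsNat, Program.keepsReal]
  refine Ends.forLoop (fun i s' => s'.real acc 0 = ∑ j ∈ Finset.range i, f j) rfl
    (fun s' hs => hlim s' (key s' hs)) (by simpa using hz) ?_ (fun _ _ h => h) hsize hL
    (by norm_num) le_rfl
  intro i hi s' hs hv hI
  refine Ends.setReal (by simp [NExpr.size, RExpr.size]; omega) ?_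
  simp [RExpr.eval, NExpr.eval, he i hi s' (key s' hs) hv, hI, Finset.sum_range_succ]

/-- A for-loop whose `i`-th pass writes `f i` into cell `o + i` of an array. The array may be one of
natural numbers or of reals, whence the parameter `arr`. -/
theorem Ends.fillLoop {α : Type} (arr : Memory → ℕ → α) (o : ℕ) (f : ℕ → α) {v : ℕ} {lim : NExpr}
    {p : Program} {s : Memory} {L B₁ : ℕ} (hv : p.keepsNat v = true)
    (harr : ∀ s c, arr (s.setNat v 0 c) = arr s)
    (hlim : ∀ s', Same (RealRAM.forLoop v lim p) s s' → lim.eval s' = L)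
    (hstep : ∀ i < L, ∀ s', Same (RealRAM.forLoop v lim p) s s' → s'.nat v 0 = i →
      Ends p s' B₁ (fun s'' => arr s'' = Function.update (arr s') (o + i) (f i)))
    (hsize : lim.size ≤ 10) (hL : 1 ≤ L) (hB₁ : 1 ≤ B₁) :
    Ends (RealRAM.forLoop v lim p) s (50 * (L * B₁))
      (fun s' => (∀ l < L, arr s' (o + l) = f l) ∧ ∀ x < o, arr s' x = arr s x) := by
  refine Ends.forLoop (fun i s' => (∀ l < i, arr s' (o + l) = f l) ∧ ∀ x < o, arr s' x = arr s x)
    hv hlim ⟨by simp, by simp [harr]⟩ ?_ (fun _ _ h => h) hsize hL hB₁ le_rfl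
  intro i hi s' hs hvi hI
  refine (hstep i hi s' hs hvi).mono le_rfl fun s'' _ hs'' => ?_
  simp only [harr, hs'']
  refine ⟨fun l hl => ?_, fun x hx => ?_⟩
  · rcases Nat.lt_succ_iff_lt_or_eq.mp hl with h | rfl
    · rw [Function.update_of_ne (by omega), hI.1 l h]
    · simp
  · rw [Function.update_of_ne (by omega), hI.2 x hx]

/-- Two nested for-loops that write `f i c` into cell `i * D + c` of an array. -/
theorem Ends.fillLoop₂ {α : Type} (arr : Memory → ℕ → α) (f : ℕ → ℕ → α) {v v' : ℕ}
    {lim lim' : NExpr} {p : Program} {s : Memory} {L D B₁ : ℕ} (hv : p.keepsNat v = true)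
    (hv' : p.keepsNat v' = true) (hvv' : v ≠ v') (harr : ∀ s c, arr (s.setNat v 0 c) = arr s)
    (harr' : ∀ s c, arr (s.setNat v' 0 c) = arr s)
    (hlim : ∀ s', Same (RealRAM.forLoop v lim (RealRAM.forLoop v' lim' p)) s s' →
      lim.eval s' = L ∧ lim'.eval s' = D)
    (hstep : ∀ i < L, ∀ c < D, ∀ s',
      Same (RealRAM.forLoop v lim (RealRAM.forLoop v' lim' p)) s s' → s'.nat v 0 = i →
      s'.nat v' 0 = c →
      Ends p s' B₁ (fun s'' => arr s'' = Function.update (arr s') (i * D + c) (f i c)))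
    (hsize : lim.size ≤ 10) (hsize' : lim'.size ≤ 10) (hL : 1 ≤ L) (hD : 1 ≤ D) (hB₁ : 1 ≤ B₁) :
    Ends (RealRAM.forLoop v lim (RealRAM.forLoop v' lim' p)) s (50 * (L * (50 * (D * B₁))))
      (fun s' => ∀ i < L, ∀ c < D, arr s' (i * D + c) = f i c) := by
  have hkeep : (RealRAM.forLoop v' lim' p).keepsNat v = true := keepsNat_forLoop.2 ⟨hvv', hv⟩
  refine Ends.forLoop (fun i s' => ∀ i' < i, ∀ c < D, arr s' (i' * D + c) = f i' c)
    hkeep (fun s' hs => (hlim s' hs).1) (by simp) ?_ (fun _ _ h => h) hsize hL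
    (Nat.mul_pos (by norm_num) (Nat.mul_pos hD hB₁)) le_rfl
  intro i hi s' hs hvi hI
  have hin : ∀ s'', Same (RealRAM.forLoop v' lim' p) s' s'' →
      Same (RealRAM.forLoop v lim (RealRAM.forLoop v' lim' p)) s s'' := fun s'' h =>
    hs.trans (h.of_keeps (fun a ha => (keepsNat_forLoop.1 ha).2)
      (fun a ha => keepsReal_forLoop.1 ha))
  refine (Ends.fillLoop arr (i * D) (f i) hv' harr' (fun s'' h => (hlim s'' (hin s'' h)).2)
    ?_ hsize' hD hB₁).mono le_rfl ?_
  · intro c hc s'' h hc'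
    exact hstep i hi c hc s'' (hin s'' h) (by rw [h.nat v hkeep, hvi]) hc'
  · rintro s'' - ⟨h1, h2⟩ i' hi' c hc
    rw [harr]
    rcases Nat.lt_succ_iff_lt_or_eq.mp hi' with h | rfl
    · rw [h2 _ (by nlinarith), hI i' h c hc]
    · exact h1 c hc

/-- Fills the natural-number array `a` with the multiples of `b`. Programs cannot multiply natural
numbers, so indices of the form `i * k + l` are computed with such tables. -/
def table (a : ℕ) (lim b : NExpr) : Program :=
  .seq (.setNat a (.lit 0) (.lit 0))
    (forLoop 10 lim (.setNat a (.plus (.var 10) (.lit 1)) (.plus (.get a (.var 10)) b)))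

theorem Ends.table {a : ℕ} {lim b : NExpr} {s : Memory} {L β : ℕ} (ha : a ≠ 10)
    (hlim : ∀ s', Same (RealRAM.table a lim b) s s' → lim.eval s' = L ∧ b.eval s' = β)
    (hsize : lim.size ≤ 10) (hsize' : b.size ≤ 10) (hL : 1 ≤ L) :
    Ends (RealRAM.table a lim b) s (2000 * L) (fun s' => ∀ x ≤ L, s'.nat a x = x * β) := by
  refine Ends.seq (B₁ := 3) (B₂ := 50 * (L * 30)) (Q₁ := fun s' => s'.nat a 0 = 0)
    (Ends.setNat (by simp [NExpr.size]) (by simp [NExpr.eval])) ?_ (by omega)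
  intro s₁ h₁ hz
  have key : ∀ s', Same (RealRAM.forLoop 10 lim (.setNat a (.plus (.var 10) (.lit 1))
      (.plus (.get a (.var 10)) b))) s₁ s' → Same (RealRAM.table a lim b) s s' := by
    intro s' hs
    refine Same.trans (h₁.of_keeps ?_ ?_) (hs.of_keeps ?_ ?_) <;> intro a ha <;>
      simp_all [RealRAM.table, Program.keepsNat, Program.keepsReal]
  refine Ends.forLoop (fun i s' => ∀ x ≤ i, s'.nat a x = x * β) (by simpa [Program.keepsNat] using
    ha.symm) (fun s' hs => (hlim s' (key s' hs)).1) (by simpa [ha] using hz) ?_ (fun _ _ h => h)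
    hsize hL (by norm_num) le_rfl
  intro i hi s' hs hv hI
  refine Ends.setNat (by simp [NExpr.size]; omega) ?_
  intro x hx
  simp only [NExpr.eval, hv, (hlim s' (key s' hs)).2, hI i le_rfl, ne_eq, ha, not_false_eq_true,
    Memory.setNat_nat_ne, Memory.setNat_nat_same]
  rcases Nat.le_succ_iff.mp hx with h | rfl
  · rw [Function.update_of_ne (by omega), hI x h]
  · simp [Nat.succ_mul]

/-- Fills the arrays `8` and `9` with the quotients and remainders of `0, …, lim` modulo `b`. -/
def divModTable (lim b : NExpr) : Program :=
  .seq (.setNat 8 (.lit 0) (.lit 0)) (.seq (.setNat 9 (.lit 0) (.lit 0))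
    (forLoop 10 lim (.ite (.natLe (.plus (.get 9 (.var 10)) (.lit 2)) b)
      (.seq (.setNat 8 (.plus (.var 10) (.lit 1)) (.get 8 (.var 10)))
        (.setNat 9 (.plus (.var 10) (.lit 1)) (.plus (.get 9 (.var 10)) (.lit 1))))
      (.seq (.setNat 8 (.plus (.var 10) (.lit 1)) (.plus (.get 8 (.var 10)) (.lit 1)))
        (.setNat 9 (.plus (.var 10) (.lit 1)) (.lit 0))))))

theorem Ends.divModTable {lim b : NExpr} {s : Memory} {L β : ℕ}
    (hlim : ∀ s', Same (RealRAM.divModTable lim b) s s' → lim.eval s' = L ∧ b.eval s' = β)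
    (hsize : lim.size ≤ 10) (hsize' : b.size ≤ 10) (hL : 1 ≤ L) (hβ : 1 ≤ β) :
    Ends (RealRAM.divModTable lim b) s (4000 * L)
      (fun s' => ∀ x ≤ L, s'.nat 8 x = x / β ∧ s'.nat 9 x = x % β) := by
  refine Ends.seq (B₁ := 3) (B₂ := 4 + 50 * (L * 50)) (Q₁ := fun s' => s'.nat 8 0 = 0)
    (Ends.setNat (by simp [NExpr.size]) (by simp [NExpr.eval])) ?_ (by omega)
  intro s₁ h₁ hz
  refine Ends.seq (B₁ := 3) (B₂ := 50 * (L * 50)) (Q₁ := fun s' => s'.nat 8 0 = 0 ∧ s'.nat 9 0 = 0)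
    (Ends.setNat (by simp [NExpr.size]) (by simp [NExpr.eval, hz])) ?_ (by omega)
  intro s₂ h₂ hz'
  refine Ends.forLoop (fun i s' => ∀ x ≤ i, s'.nat 8 x = x / β ∧ s'.nat 9 x = x % β) rfl
    (fun s' hs => (hlim s' ?_).1) (by simpa using hz') ?_ (fun _ _ h => h)
    hsize hL (by norm_num) le_rfl
  · refine Same.trans (h₁.of_keeps ?_ ?_) (Same.trans (h₂.of_keeps ?_ ?_) (hs.of_keeps ?_ ?_)) <;>
      intro a ha <;> simp_all [RealRAM.divModTable, Program.keepsNat, Program.keepsReal]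
  intro i hi s' hs hv hI
  have hβ' : b.eval s' = β := by
    refine (hlim s' ?_).2
    refine Same.trans (h₁.of_keeps ?_ ?_) (Same.trans (h₂.of_keeps ?_ ?_) (hs.of_keeps ?_ ?_)) <;>
      intro a ha <;> simp_all [RealRAM.divModTable, Program.keepsNat, Program.keepsReal]
  obtain ⟨hq, hr⟩ := hI i le_rfl
  have hdm := Nat.div_add_mod i β
  have hlt := Nat.mod_lt i hβ
  have hcarry : (i % β + 2 ≤ β → (i + 1) / β = i / β ∧ (i + 1) % β = i % β + 1) ∧
      (¬ i % β + 2 ≤ β → (i + 1) / β = i / β + 1 ∧ (i + 1) % β = 0) := by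
    refine ⟨fun hb => ?_, fun hb => ?_⟩ <;> refine (Nat.div_mod_unique hβ).2 ⟨?_, by omega⟩
    · omega
    · rw [Nat.mul_add, Nat.mul_one]; omega
  refine Ends.ite (B₁ := 25) ?_ ?_ (by simp [Test.size, NExpr.size]; omega)
  all_goals
    intro hb
    simp only [Test.eval, NExpr.eval, hv, hr, hβ'] at hb
    refine Ends.seq (B₁ := 10) (B₂ := 10) (Ends.setNat (Q := fun s'' => s'' = _)
      (by simp [NExpr.size]) rfl) ?_ (by norm_num)
    rintro s'' - rfl
    refine Ends.setNat (by simp [NExpr.size]) ?_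
    intro x hx
    simp only [NExpr.eval, Memory.setNat_nat_same, Memory.setNat_nat_ne, ne_eq,
      Nat.reduceEqDiff, not_false_eq_true, hv, hq, hr]
    rcases Nat.le_succ_iff.mp hx with h | rfl
    · rw [Function.update_of_ne (by omega), Function.update_of_ne (by omega)]
      exact hI x h
    · simp only [Nat.succ_eq_add_one, Function.update_self]
      first
        | exact ⟨(hcarry.1 hb).1.symm, (hcarry.1 hb).2.symm⟩
        | exact ⟨(hcarry.2 hb).1.symm, (hcarry.2 hb).2.symm⟩

end RealRAM

namespace ChromaticClustering

open RealRAM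

/-! ### The algorithm -/

/-!
A variable is cell `0` of an array and is denoted by the number of that array. The arrays that are
not listed here hold auxiliary variables.

Natural-number arrays: `0` the input `n, d, k`; `1` the output clusters; `2` the variable `m`; `3` the
variable `R`; `4`, `5`, `6` the multiples of `k`, `d`, `m`; `7` the random tape; `8`, `9` quotients and
remainders modulo `k`; `10` to `18` loop counters (`10` trial, `11` center, `12` sample,
`13` coordinate, `14` point-set, `15` point of a point-set, `16` code of an assignment); `24` the
digits of a code; `25` the clusters of the current trial.

Real arrays: `0` the input `ε`; `1` the points; `2` the output centers; `3` the centers of the current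
trial; `4` the squared distances between the points of a point-set and these centers.
-/

/-- The number `n` of point-sets. -/
abbrev nVar : NExpr := .get 0 (.lit 0)

/-- The dimension `d`. -/
abbrev dVar : NExpr := .get 0 (.lit 1)

/-- The number `k` of clusters. -/
abbrev kVar : NExpr := .get 0 (.lit 2)

/-- The number `m` of samples for each center. -/
abbrev mVar : NExpr := .get 2 (.lit 0)

/-- The number `R` of trials. -/
abbrev rVar : NExpr := .get 3 (.lit 0)

/-- The centers of the trial with number `10`, that is, the number stored in the natural-number
variable `10`: center `j` is the mean of its `m` sampled points. They are stored in the real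
array `3`. -/
def centersProg : Program :=
  forLoop 11 kVar (forLoop 13 dVar (.seq
    (sumLoop 12 mVar 5 (.get 1 (.plus (.get 5 (.get 7
      (.plus (.get 6 (.plus (.get 4 (.var 10)) (.var 11))) (.var 12)))) (.var 13))))
    (.setReal 3 (.plus (.get 5 (.var 11)) (.var 13)) (.quot (.get 5 (.lit 0)) (.ofNat mVar)))))

/-- The difference in coordinate `13` between the point `15` of the point-set `14` and the
center `11`. -/
def diffExpr : RExpr :=
  .minus (.get 1 (.plus (.get 5 (.plus (.get 4 (.var 14)) (.var 15))) (.var 13)))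
    (.get 3 (.plus (.get 5 (.var 11)) (.var 13)))

/-- The squared distances between the points of the point-set `14` and the centers are stored in
the real array `4`. -/
def weightsProg : Program :=
  forLoop 15 kVar (forLoop 11 kVar (.seq (sumLoop 13 dVar 5 (.times diffExpr diffExpr))
    (.setReal 4 (.plus (.get 4 (.var 15)) (.var 11)) (.get 5 (.lit 0)))))

/-- The base-`k` digits of the number `16` are stored in the natural-number array `24`, and the cost
of the assignment that they encode in the real variable `5`. -/
def digitsProg : Program :=
  .seq (.setNat 20 (.lit 0) (.var 16)) (.seq (.setReal 5 (.lit 0) (.ofNat (.lit 0)))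
    (forLoop 15 kVar (.seq (.setNat 24 (.var 15) (.get 9 (.var 20)))
      (.seq (.setNat 20 (.lit 0) (.get 8 (.var 20)))
        (.setReal 5 (.lit 0) (.plus (.get 5 (.lit 0))
          (.get 4 (.plus (.get 4 (.var 15)) (.get 24 (.var 15))))))))))

/-- The variable `22` is set to `0` if and only if the digits are distinct. -/
def distinctProg : Program :=
  .seq (.setNat 22 (.lit 0) (.lit 0))
    (forLoop 17 kVar (forLoop 18 kVar (.ite
      (.both (.natLe (.plus (.var 18) (.lit 1)) (.var 17))
        (.both (.natLe (.get 24 (.var 17)) (.get 24 (.var 18)))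
          (.natLe (.get 24 (.var 18)) (.get 24 (.var 17)))))
      (.setNat 22 (.lit 0) (.lit 1)) .skip)))

/-- A cheapest bijective assignment of the point-set `14` to the centers is stored in the
corresponding row of the natural-number array `25`, and its cost in the real variable `6`. All
numbers below `R` are tried as codes of assignments. The variable `21` is positive once a bijective assignment has been found. -/
def assignProg : Program :=
  .seq (.setNat 21 (.lit 0) (.lit 0))
    (forLoop 16 rVar (.seq digitsProg (.seq distinctProg (.ite
      (.both (.natLe (.var 22) (.lit 0)) (.neg (.both (.natLe (.lit 1) (.var 21))
        (.realLe (.get 6 (.lit 0)) (.get 5 (.lit 0))))))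
      (.seq (.setNat 21 (.lit 0) (.lit 1)) (.seq (.setReal 6 (.lit 0) (.get 5 (.lit 0)))
        (forLoop 15 kVar
          (.setNat 25 (.plus (.get 4 (.var 14)) (.var 15)) (.get 24 (.var 15))))))
      .skip))))

/-- Cheapest assignments of all point-sets to the centers; the total cost is stored in the real
variable `7`. -/
def scoreProg : Program :=
  .seq (.setReal 7 (.lit 0) (.ofNat (.lit 0)))
    (forLoop 14 nVar (.seq weightsProg (.seq assignProg
      (.setReal 7 (.lit 0) (.plus (.get 7 (.lit 0)) (.get 6 (.lit 0)))))))

/-- Copies the current solution to the output. -/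
def recordProg : Program :=
  .seq (.setNat 23 (.lit 0) (.lit 1)) (.seq (.setReal 8 (.lit 0) (.get 7 (.lit 0)))
    (.seq
      (forLoop 11 kVar (forLoop 13 dVar (.setReal 2 (.plus (.get 5 (.var 11)) (.var 13))
        (.get 3 (.plus (.get 5 (.var 11)) (.var 13))))))
      (forLoop 14 nVar (forLoop 15 kVar (.setNat 1 (.plus (.get 4 (.var 14)) (.var 15))
        (.get 25 (.plus (.get 4 (.var 14)) (.var 15))))))))

/-- The cheapest solution of all trials becomes the output, and its cost the value of the real
variable `8`. The variable `23` is positive once a solution has been recorded. -/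
def trialsProg : Program :=
  .seq (.setNat 23 (.lit 0) (.lit 0))
    (forLoop 10 rVar (.seq centersProg (.seq scoreProg (.ite
      (.neg (.both (.natLe (.lit 1) (.var 23)) (.realLe (.get 8 (.lit 0)) (.get 7 (.lit 0)))))
      recordProg .skip))))

/-- The sample size `m`, the least natural number with `2 ≤ m * ε`. -/
def sampleSizeProg : Program :=
  .loop (.neg (.realLe (.ofNat (.lit 2)) (.times (.ofNat mVar) (.get 0 (.lit 0)))))
    (.setNat 2 (.lit 0) (.plus mVar (.lit 1)))

/-- The number of trials `R = 2 ^ (k * k * m)`, computed by repeated doubling. -/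
def trialCountProg : Program :=
  .seq (.setNat 3 (.lit 0) (.lit 1)) (forLoop 11 kVar (forLoop 12 kVar (forLoop 13 mVar
    (.setNat 3 (.lit 0) (.plus rVar rVar)))))

/-- Everything that precedes the random choices. -/
def setupProg : Program :=
  .seq sampleSizeProg (.seq trialCountProg (.seq (table 4 (.plus nVar (.plus kVar rVar)) kVar)
    (.seq (table 5 (.get 4 nVar) dVar) (.seq (table 6 (.get 4 rVar) mVar)
      (divModTable rVar kVar)))))

/-- The random choice of `m` points for each of the `k` centers in each of the `R` trials. -/
def samplingProg : Program :=
  forLoop 10 (.get 6 (.get 4 rVar)) (.rand 7 (.var 10) (.get 4 nVar))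

/-- The whole algorithm. -/
def mainProg : Program := .seq setupProg (.seq samplingProg trialsProg)

/-! ### Correctness of the algorithm for a given tape -/

/-- What the program knows after its setup: the parameters, the tables of multiples of `k`, `d`
and `m`, the table of quotients and remainders modulo `k`, and the coordinates `X` of the points;
`W` is the content of the random tape. -/
structure Env (n d k m R : ℕ) (X : ℕ → ℝ) (W : ℕ → ℕ) (s : Memory) : Prop where
  n_eq : s.nat 0 0 = n
  d_eq : s.nat 0 1 = d
  k_eq : s.nat 0 2 = k
  m_eq : s.nat 2 0 = m
  r_eq : s.nat 3 0 = R
  mul_k : ∀ x ≤ n + (k + R), s.nat 4 x = x * k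
  mul_d : ∀ x ≤ n * k, s.nat 5 x = x * d
  mul_m : ∀ x ≤ R * k, s.nat 6 x = x * m
  tape : s.nat 7 = W
  div_mod : ∀ x ≤ R, s.nat 8 x = x / k ∧ s.nat 9 x = x % k
  points : s.real 1 = X

theorem Env.of_same {n d k m R : ℕ} {X : ℕ → ℝ} {W : ℕ → ℕ} {s s' : Memory} {p : Program}
    (h : Env n d k m R X W s) (hs : Same p s s')
    (hp : (∀ a ∈ [0, 2, 3, 4, 5, 6, 7, 8, 9], p.keepsNat a = true) ∧ p.keepsReal 1 = true) :
    Env n d k m R X W s' := by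
  simp only [List.mem_cons, List.not_mem_nil, or_false, forall_eq_or_imp, forall_eq] at hp
  obtain ⟨⟨h0, h2, h3, h4, h5, h6, h7, h8, h9⟩, hr⟩ := hp
  constructor
  · rw [hs.nat 0 h0, h.n_eq]
  · rw [hs.nat 0 h0, h.d_eq]
  · rw [hs.nat 0 h0, h.k_eq]
  · rw [hs.nat 2 h2, h.m_eq]
  · rw [hs.nat 3 h3, h.r_eq]
  · rw [hs.nat 4 h4]; exact h.mul_k
  · rw [hs.nat 5 h5]; exact h.mul_d
  · rw [hs.nat 6 h6]; exact h.mul_m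
  · rw [hs.nat 7 h7, h.tape]
  · rw [hs.nat 8 h8, hs.nat 9 h9]; exact h.div_mod
  · rw [hs.real 1 hr, h.points]

/-- Coordinate `c` of center `j` in trial `t`. -/
noncomputable def trialCenter (d k m : ℕ) (X : ℕ → ℝ) (W : ℕ → ℕ) (t j c : ℕ) : ℝ :=
  (∑ i ∈ Finset.range m, X (W ((t * k + j) * m + i) * d + c)) / m

/-- The squared distance between point `l` of point-set `i` and the center `j`, whose coordinates
are given by `ctr`. -/
def weight (d k : ℕ) (X : ℕ → ℝ) (ctr : ℕ → ℕ → ℝ) (i l j : ℕ) : ℝ :=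
  ∑ c ∈ Finset.range d, (X ((i * k + l) * d + c) - ctr j c) ^ 2

/-- The function `f` permutes `{0, …, k - 1}`. -/
def IsPerm (k : ℕ) (f : ℕ → ℕ) : Prop := (∀ l < k, f l < k) ∧ ∀ a < k, ∀ b < a, f a ≠ f b

section

variable {n d k m R : ℕ} {X : ℕ → ℝ} {W : ℕ → ℕ} {s : Memory}

theorem ends_centersProg (hE : Env n d k m R X W s)
    (hW : ∀ x < R * k * m, W x < n * k) (hn : 1 ≤ n) (hd : 1 ≤ d) (hk : 1 ≤ k) (hm : 1 ≤ m)
    {t : ℕ} (ht : t < R) (hst : s.nat 10 0 = t) :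
    Ends centersProg s (50 * (k * (50 * (d * (4000 * m)))))
      (fun s' => ∀ j < k, ∀ c < d, s'.real 3 (j * d + c) = trialCenter d k m X W t j c) := by
  refine Ends.fillLoop₂ (fun s => s.real 3) _ rfl rfl (by norm_num) (fun _ _ => rfl)
    (fun _ _ => rfl) ?_ ?_ (by simp [NExpr.size]) (by simp [NExpr.size]) hk hd (by omega)
  · intro s₁ h₁
    have hE₁ := hE.of_same h₁ (by decide)
    exact ⟨hE₁.k_eq, hE₁.d_eq⟩
  intro j hj c hc s₁ h₁ hj₁ hc₁
  have hE₁ := hE.of_same h₁ (by decide)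
  have ht₁ : s₁.nat 10 0 = t := by rw [h₁.nat 10 rfl, hst]
  refine Ends.seq (B₁ := 3000 * m) (B₂ := 50) (Ends.sumLoop
    (fun i => X (W ((t * k + j) * m + i) * d + c)) ?_ ?_ (by simp [NExpr.size])
    (by simp [NExpr.size, RExpr.size]) hm) ?_ (by omega)
  · intro s₂ h₂
    exact (hE₁.of_same h₂ (by decide)).m_eq
  · intro i hi s₂ h₂ hi₂
    have hE₂ := hE₁.of_same h₂ (by decide)
    have ht₂ : s₂.nat 10 0 = t := by rw [h₂.nat 10 rfl, ht₁]
    have hj₂ : s₂.nat 11 0 = j := by rw [h₂.nat 11 rfl, hj₁]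
    have hc₂ : s₂.nat 13 0 = c := by rw [h₂.nat 13 rfl, hc₁]
    have h1 : t * k + j < R * k := by
      have : (t + 1) * k ≤ R * k := Nat.mul_le_mul_right _ ht
      rw [Nat.succ_mul] at this; omega
    have h2 : (t * k + j) * m + i < R * k * m := by
      have : (t * k + j + 1) * m ≤ R * k * m := Nat.mul_le_mul_right _ h1
      rw [Nat.succ_mul] at this; omega
    simp only [RExpr.eval, NExpr.eval, ht₂, hj₂, hc₂, hi₂, hE₂.mul_k t (by omega),
      hE₂.mul_m _ h1.le, hE₂.tape, hE₂.mul_d _ (hW _ h2).le, hE₂.points]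
  · intro s₂ h₂ hsum
    have hE₂ := hE₁.of_same h₂ (by decide)
    have hj₂ : s₂.nat 11 0 = j := by rw [h₂.nat 11 rfl, hj₁]
    have hc₂ : s₂.nat 13 0 = c := by rw [h₂.nat 13 rfl, hc₁]
    have hjn : j ≤ n * k := hj.le.trans (Nat.le_mul_of_pos_left _ hn)
    refine Ends.setReal (by simp [NExpr.size, RExpr.size]) ?_
    simp only [RExpr.eval, NExpr.eval, hj₂, hc₂, hE₂.mul_d _ hjn, hE₂.m_eq, hsum,
      Memory.setReal_real_same, h₂.real 3 rfl, trialCenter]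

theorem ends_weightsProg (hE : Env n d k m R X W s) (hn : 1 ≤ n) (hd : 1 ≤ d) (hk : 1 ≤ k)
    {i : ℕ} (hi : i < n) (hsi : s.nat 14 0 = i) {ctr : ℕ → ℕ → ℝ}
    (hctr : ∀ j < k, ∀ c < d, s.real 3 (j * d + c) = ctr j c) :
    Ends weightsProg s (50 * (k * (50 * (k * (4000 * d)))))
      (fun s' => ∀ l < k, ∀ j < k, s'.real 4 (l * k + j) = weight d k X ctr i l j) := by
  refine Ends.fillLoop₂ (fun s => s.real 4) _ rfl rfl (by norm_num) (fun _ _ => rfl)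
    (fun _ _ => rfl) ?_ ?_ (by simp [NExpr.size]) (by simp [NExpr.size]) hk hk (by omega)
  · intro s₁ h₁
    have hE₁ := hE.of_same h₁ (by decide)
    exact ⟨hE₁.k_eq, hE₁.k_eq⟩
  intro l hl j hj s₁ h₁ hl₁ hj₁
  have hE₁ := hE.of_same h₁ (by decide)
  have hi₁ : s₁.nat 14 0 = i := by rw [h₁.nat 14 rfl, hsi]
  have hr₁ : s₁.real 3 = s.real 3 := h₁.real 3 rfl
  refine Ends.seq (B₁ := 3000 * d) (B₂ := 50) (Ends.sumLoop
    (fun c => (X ((i * k + l) * d + c) - ctr j c) ^ 2) ?_ ?_ (by simp [NExpr.size])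
    (by simp [NExpr.size, RExpr.size, diffExpr]) hd) ?_ (by omega)
  · intro s₂ h₂
    exact (hE₁.of_same h₂ (by decide)).d_eq
  · intro c hc s₂ h₂ hc₂
    have hE₂ := hE₁.of_same h₂ (by decide)
    have hi₂ : s₂.nat 14 0 = i := by rw [h₂.nat 14 rfl, hi₁]
    have hj₂ : s₂.nat 11 0 = j := by rw [h₂.nat 11 rfl, hj₁]
    have hl₂ : s₂.nat 15 0 = l := by rw [h₂.nat 15 rfl, hl₁]
    have hr₂ : s₂.real 3 = s.real 3 := by rw [h₂.real 3 rfl, hr₁]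
    have h1 : i * k + l ≤ n * k := by
      have : (i + 1) * k ≤ n * k := Nat.mul_le_mul_right _ hi
      rw [Nat.succ_mul] at this; omega
    have hjn : j ≤ n * k := hj.le.trans (Nat.le_mul_of_pos_left _ hn)
    simp only [diffExpr, RExpr.eval, NExpr.eval, hi₂, hj₂, hl₂, hc₂, hE₂.mul_k i (by omega),
      hE₂.mul_d _ h1, hE₂.mul_d _ hjn, hE₂.points, hr₂, hctr j hj c hc, pow_two]
  · intro s₂ h₂ hsum
    have hE₂ := hE₁.of_same h₂ (by decide)
    have hj₂ : s₂.nat 11 0 = j := by rw [h₂.nat 11 rfl, hj₁]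
    have hl₂ : s₂.nat 15 0 = l := by rw [h₂.nat 15 rfl, hl₁]
    refine Ends.setReal (by simp [NExpr.size, RExpr.size]) ?_
    simp only [RExpr.eval, NExpr.eval, hj₂, hl₂, hE₂.mul_k l (by omega), hsum,
      Memory.setReal_real_same, h₂.real 4 rfl, weight]

theorem ends_digitsProg (hE : Env n d k m R X W s) (hk : 1 ≤ k) {x : ℕ} (hx : x < R)
    (hsx : s.nat 16 0 = x) {w : ℕ → ℕ → ℝ}
    (hw : ∀ l < k, ∀ j < k, s.real 4 (l * k + j) = w l j) :
    Ends digitsProg s (6000 * k) (fun s' => (∀ l < k, s'.nat 24 l = x / k ^ l % k) ∧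
      s'.real 5 0 = ∑ l ∈ Finset.range k, w l (x / k ^ l % k)) := by
  refine Ends.seq (B₁ := 10) (B₂ := 50 * (k * 100) + 20) (Q₁ := fun s' => s'.nat 20 0 = x)
    (Ends.setNat (by simp [NExpr.size]) (by simp [NExpr.eval, hsx])) ?_ (by omega)
  intro s₁ h₁ hy₁
  refine Ends.seq (B₁ := 10) (B₂ := 50 * (k * 100)) (Q₁ := fun s' => s'.real 5 0 = 0)
    (Ends.setReal (by simp [NExpr.size, RExpr.size]) (by simp [NExpr.eval, RExpr.eval])) ?_
    (by omega)
  intro s₂ h₂ hz₂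
  have hE₂ := (hE.of_same h₁ (by decide)).of_same h₂ (by decide)
  have hy₂ : s₂.nat 20 0 = x := by rw [h₂.nat 20 rfl, hy₁]
  have hr₂ : s₂.real 4 = s.real 4 := by rw [h₂.real 4 rfl, h₁.real 4 rfl]
  refine Ends.forLoop (fun l s' => s'.nat 20 0 = x / k ^ l ∧
    (∀ l' < l, s'.nat 24 l' = x / k ^ l' % k) ∧
    s'.real 5 0 = ∑ l' ∈ Finset.range l, w l' (x / k ^ l' % k)) rfl
    (fun s' h => (hE₂.of_same h (by decide)).k_eq) (by simp [hy₂, hz₂]) ?_ (fun s' _ h => h.2)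
    (by simp [NExpr.size]) hk (by norm_num) le_rfl
  rintro l hl s₃ h₃ hl₃ ⟨hy, hdig, hsum⟩
  have hE₃ := hE₂.of_same h₃ (by decide)
  have hr₃ : s₃.real 4 = s.real 4 := by rw [h₃.real 4 rfl, hr₂]
  have hle : x / k ^ l ≤ R := (Nat.div_le_self _ _).trans hx.le
  refine Ends.seq (B₁ := 20) (B₂ := 60) (Ends.setNat (Q := fun s' => s' = _)
    (by simp [NExpr.size]) rfl) ?_ (by norm_num)
  rintro s₄ h₄ rfl
  refine Ends.seq (B₁ := 20) (B₂ := 30) (Ends.setNat (Q := fun s' => s' = _)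
    (by simp [NExpr.size]) rfl) ?_ (by norm_num)
  rintro s₅ h₅ rfl
  refine Ends.setReal (by simp [NExpr.size, RExpr.size]) ?_
  have e : s₃.nat 20 0 / k = x / k ^ (l + 1) := by
    rw [hy, Nat.div_div_eq_div_mul, pow_succ]
  simp only [NExpr.eval, RExpr.eval, Memory.setNat_nat_same, Memory.setNat_nat_ne, ne_eq,
    Nat.reduceEqDiff, not_false_eq_true, Memory.setReal_nat, Memory.setNat_real,
    Memory.setReal_real_same, Function.update_self, hl₃, hy, (hE₃.div_mod _ hle).1,
    (hE₃.div_mod _ hle).2, hE₃.mul_k l (by omega), hr₃, hw l hl _ (Nat.mod_lt _ hk), hsum,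
    Finset.sum_range_succ, and_true]
  refine ⟨by rw [← e, hy], fun l' hl' => ?_⟩
  rcases Nat.lt_succ_iff_lt_or_eq.mp hl' with h | rfl
  · rw [Function.update_of_ne (by omega), hdig l' h]
  · simp

theorem ends_distinctProg (hk : 1 ≤ k) (hsk : s.nat 0 2 = k) :
    Ends distinctProg s (200000 * (k * k))
      (fun s' => s'.nat 22 0 = 0 ↔ ∀ a < k, ∀ b < a, s.nat 24 a ≠ s.nat 24 b) := by
  have hkk : 1 ≤ k * k := Nat.mul_pos hk hk
  refine Ends.seq (B₁ := 10) (B₂ := 50 * (k * (50 * (k * 50)))) (Q₁ := fun s' => s'.nat 22 0 = 0)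
    (Ends.setNat (by simp [NExpr.size]) (by simp [NExpr.eval])) ?_ (by
      have : 50 * (k * (50 * (k * 50))) = 125000 * (k * k) := by ring
      omega)
  intro s₁ h₁ hz₁
  have hk₁ : s₁.nat 0 2 = k := by rw [h₁.nat 0 rfl, hsk]
  have hd₁ : s₁.nat 24 = s.nat 24 := h₁.nat 24 rfl
  refine Ends.forLoop (fun a s' => s'.nat 22 0 = 0 ↔ ∀ a' < a, ∀ b < a', s.nat 24 a' ≠ s.nat 24 b)
    rfl (fun s' h => by simp [NExpr.eval, h.nat 0 rfl, hk₁]) (by simp [hz₁]) ?_ (fun s' _ h => h)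
    (by simp [NExpr.size]) hk (by omega) le_rfl
  intro a ha s₂ h₂ ha₂ hI₂
  have hk₂ : s₂.nat 0 2 = k := by rw [h₂.nat 0 rfl, hk₁]
  have hd₂ : s₂.nat 24 = s.nat 24 := by rw [h₂.nat 24 rfl, hd₁]
  refine Ends.forLoop (fun b s' => s'.nat 22 0 = 0 ↔
      (∀ a' < a, ∀ b < a', s.nat 24 a' ≠ s.nat 24 b) ∧
      ∀ b' < b, b' < a → s.nat 24 a ≠ s.nat 24 b')
    rfl (fun s' h => by simp [NExpr.eval, h.nat 0 rfl, hk₂]) (by simpa using hI₂) ?_ ?_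
    (by simp [NExpr.size]) hk (by omega) le_rfl
  · intro b hb s₃ h₃ hb₃ hI₃
    have hd₃ : s₃.nat 24 = s.nat 24 := by rw [h₃.nat 24 rfl, hd₂]
    have ha₃ : s₃.nat 17 0 = a := by rw [h₃.nat 17 rfl, ha₂]
    have hsplit : (∀ b' < b + 1, b' < a → s.nat 24 a ≠ s.nat 24 b') ↔
        (∀ b' < b, b' < a → s.nat 24 a ≠ s.nat 24 b') ∧ (b < a → s.nat 24 a ≠ s.nat 24 b) :=
      ⟨fun h => ⟨fun b' hb' => h b' (by omega), h b (by omega)⟩, fun h b' hb' => by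
        rcases Nat.lt_succ_iff_lt_or_eq.mp hb' with h' | rfl
        exacts [h.1 b' h', h.2]⟩
    refine Ends.ite (B₁ := 10) ?_ ?_ (by simp [Test.size, NExpr.size])
    · intro ht
      simp only [Test.eval, NExpr.eval, hb₃, ha₃, hd₃] at ht
      refine Ends.setNat (by simp [NExpr.size]) ?_
      simp [NExpr.eval]
      exact fun _ => ⟨b, le_rfl, by omega, by omega⟩
    · intro ht
      simp only [Test.eval, NExpr.eval, hb₃, ha₃, hd₃] at ht
      refine Ends.skip (by norm_num) ?_
      have : b < a → s.nat 24 a ≠ s.nat 24 b := by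
        intro h h'; exact ht ⟨by omega, by omega, by omega⟩
      rw [Memory.setNat_nat_ne _ _ _ (by norm_num), hsplit, hI₃]
      tauto
  · intro s₃ h₃ hI₃
    simp only [ne_eq, Nat.reduceEqDiff, not_false_eq_true, Memory.setNat_nat_ne]
    refine hI₃.trans ⟨fun h a' ha' b hb => ?_, fun h => ⟨fun a' ha' => h a' (by omega),
      fun b _ hba => h a (by omega) b hba⟩⟩
    rcases Nat.lt_succ_iff_lt_or_eq.mp ha' with h' | rfl
    exacts [h.1 a' h' b hb, h.2 b (by omega) hb]

end

/-- Every list of `k` digits in base `k` belongs to a number below `k ^ k`. -/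
theorem exists_digits {k : ℕ} {f : ℕ → ℕ} (hf : ∀ l < k, f l < k) :
    ∃ x < k ^ k, ∀ l < k, x / k ^ l % k = f l := by
  let g : Fin k → Fin k := fun l => ⟨f l, hf l l.2⟩
  refine ⟨finFunctionFinEquiv g, (finFunctionFinEquiv g).2, fun l hl => ?_⟩
  have h := finFunctionFinEquiv_symm_apply_val (finFunctionFinEquiv g) ⟨l, hl⟩
  rw [Equiv.symm_apply_apply] at h
  exact h.symm

theorem IsPerm.congr {k : ℕ} {f g : ℕ → ℕ} (hf : IsPerm k f) (h : ∀ l < k, g l = f l) :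
    IsPerm k g :=
  ⟨fun l hl => by rw [h l hl]; exact hf.1 l hl, fun a ha b hb => by
    rw [h a ha, h b (hb.trans ha)]; exact hf.2 a ha b hb⟩

section

variable {n d k m R : ℕ} {X : ℕ → ℝ} {W : ℕ → ℕ} {s : Memory}

theorem ends_assignProg (hE : Env n d k m R X W s) (hk : 1 ≤ k) (hR : k ^ k ≤ R)
    {i : ℕ} (hi : i < n) (hsi : s.nat 14 0 = i) {w : ℕ → ℕ → ℝ}
    (hw : ∀ l < k, ∀ j < k, s.real 4 (l * k + j) = w l j) :
    Ends assignProg s (20000000 * (R * (k * k))) (fun s' =>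
      IsPerm k (fun l => s'.nat 25 (i * k + l)) ∧
      s'.real 6 0 = ∑ l ∈ Finset.range k, w l (s'.nat 25 (i * k + l)) ∧
      (∀ f, IsPerm k f → s'.real 6 0 ≤ ∑ l ∈ Finset.range k, w l (f l)) ∧
      ∀ x < i * k, s'.nat 25 x = s.nat 25 x) := by
  have hkk : k ≤ k * k := Nat.le_mul_of_pos_left _ hk
  have hR1 : 1 ≤ R := (Nat.one_le_pow _ _ hk).trans hR
  have hRkk : 1 ≤ R * (k * k) := Nat.mul_pos hR1 (by omega)
  refine Ends.seq (B₁ := 10) (B₂ := 50 * (R * (300000 * (k * k))))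
    (Q₁ := fun s' => s'.nat 21 0 = 0)
    (Ends.setNat (by simp [NExpr.size]) (by simp [NExpr.eval])) ?_ (by
      have : 50 * (R * (300000 * (k * k))) = 15000000 * (R * (k * k)) := by ring
      omega)
  intro s₁ h₁ hz₁
  have hE₁ := hE.of_same h₁ (by decide)
  have hr₁ : s₁.real 4 = s.real 4 := h₁.real 4 rfl
  have hc₁ : s₁.nat 25 = s.nat 25 := h₁.nat 25 rfl
  have hi₁ : s₁.nat 14 0 = i := by rw [h₁.nat 14 rfl, hsi]
  refine Ends.forLoop (fun x s' =>
    (∀ y < x, IsPerm k (fun l => y / k ^ l % k) → 1 ≤ s'.nat 21 0 ∧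
      s'.real 6 0 ≤ ∑ l ∈ Finset.range k, w l (y / k ^ l % k)) ∧
    (1 ≤ s'.nat 21 0 → IsPerm k (fun l => s'.nat 25 (i * k + l)) ∧
      s'.real 6 0 = ∑ l ∈ Finset.range k, w l (s'.nat 25 (i * k + l))) ∧
    ∀ x < i * k, s'.nat 25 x = s.nat 25 x) rfl
    (fun s' h => (hE₁.of_same h (by decide)).r_eq) (by simp [hz₁, hc₁]) ?_ ?_
    (by simp [NExpr.size]) hR1 (by omega) le_rfl
  · rintro x hx s₂ h₂ hx₂ ⟨hall, hfound, hold⟩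
    have hE₂ := hE₁.of_same h₂ (by decide)
    have hr₂ : s₂.real 4 = s.real 4 := by rw [h₂.real 4 rfl, hr₁]
    have hi₂ : s₂.nat 14 0 = i := by rw [h₂.nat 14 rfl, hi₁]
    refine Ends.seq (B₁ := 6000 * k) (B₂ := 210000 * (k * k))
      (ends_digitsProg (w := w) hE₂ hk hx hx₂ (by rw [hr₂]; exact hw)) ?_ (by omega)
    rintro s₃ h₃ ⟨hdig₃, hcost₃⟩
    have hE₃ := hE₂.of_same h₃ (by decide)
    refine Ends.seq (B₁ := 200000 * (k * k)) (B₂ := 5000 * k)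
      (ends_distinctProg hk hE₃.k_eq) ?_ (by omega)
    intro s₄ h₄ hdist
    have hE₄ := hE₃.of_same h₄ (by decide)
    have hdig₄ : ∀ l < k, s₄.nat 24 l = x / k ^ l % k := by rw [h₄.nat 24 rfl]; exact hdig₃
    have hcost₄ : s₄.real 5 0 = ∑ l ∈ Finset.range k, w l (x / k ^ l % k) := by
      rw [h₄.real 5 rfl, hcost₃]
    have h25 : s₄.nat 25 = s₂.nat 25 := by rw [h₄.nat 25 rfl, h₃.nat 25 rfl]
    have h21 : s₄.nat 21 = s₂.nat 21 := by rw [h₄.nat 21 rfl, h₃.nat 21 rfl]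
    have h6 : s₄.real 6 = s₂.real 6 := by rw [h₄.real 6 rfl, h₃.real 6 rfl]
    have hi₄ : s₄.nat 14 0 = i := by rw [h₄.nat 14 rfl, h₃.nat 14 rfl, hi₂]
    have hperm : s₄.nat 22 0 = 0 ↔ IsPerm k (fun l => x / k ^ l % k) := by
      rw [hdist]
      refine ⟨fun h => ⟨fun l _ => Nat.mod_lt _ hk, fun a ha b hb => ?_⟩, fun h a ha b hb => ?_⟩
      · change x / k ^ a % k ≠ x / k ^ b % k
        rw [← hdig₃ a ha, ← hdig₃ b (hb.trans ha)]; exact h a ha b hb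
      · rw [hdig₃ a ha, hdig₃ b (hb.trans ha)]; exact h.2 a ha b hb
    refine Ends.ite (B₁ := 4000 * k) ?_ ?_ (by simp [Test.size, NExpr.size, RExpr.size]; omega)
    · intro ht
      simp only [Test.eval, NExpr.eval, RExpr.eval, h21, h6, Nat.le_zero] at ht
      obtain ⟨ht0, htn⟩ := ht
      rw [hperm] at ht0
      refine Ends.seq (B₁ := 10) (B₂ := 50 * (k * 50) + 20) (Ends.setNat (Q := fun s' => s' = _)
        (by simp [NExpr.size]) rfl) ?_ (by omega)
      rintro s₅ h₅ rfl
      refine Ends.seq (B₁ := 10) (B₂ := 50 * (k * 50)) (Ends.setReal (Q := fun s' => s' = _)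
        (by simp [NExpr.size, RExpr.size]) rfl) ?_ (by omega)
      rintro s₆ h₆ rfl
      have hE₆ := (hE₄.of_same h₅ (by decide)).of_same h₆ (by decide)
      refine (Ends.fillLoop (fun s => s.nat 25) (i * k) (fun l => x / k ^ l % k)
        (v := 15) (lim := kVar) (L := k) (B₁ := 50) rfl (fun _ _ => by simp)
        (fun s' h => (hE₆.of_same h (by decide)).k_eq) ?_
        (by simp [NExpr.size]) hk (by norm_num)).mono le_rfl ?_
      · intro l hl s₇ h₇ hl₇
        have hE₇ := hE₆.of_same h₇ (by decide)
        have hi₇ : s₇.nat 14 0 = i := by rw [h₇.nat 14 rfl, h₆.nat 14 rfl, h₅.nat 14 rfl, hi₄]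
        have h24 : s₇.nat 24 l = x / k ^ l % k := by
          rw [h₇.nat 24 rfl, h₆.nat 24 rfl, h₅.nat 24 rfl, hdig₄ l hl]
        refine Ends.setNat (by simp [NExpr.size]) ?_
        simp only [NExpr.eval, hl₇, hi₇, hE₇.mul_k i (by omega), h24, Memory.setNat_nat_same]
      · rintro s₇ h₇ ⟨hrow, hold₇⟩
        simp only [Memory.setNat_nat_ne, ne_eq, Memory.setReal_nat,
          Nat.reduceEqDiff, not_false_eq_true, h25] at hold₇
        have hf : s₇.nat 21 0 = 1 := by
          rw [h₇.nat 21 rfl]; simp [NExpr.eval]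
        have hb : s₇.real 6 0 = ∑ l ∈ Finset.range k, w l (x / k ^ l % k) := by
          rw [h₇.real 6 rfl]; simp [RExpr.eval, NExpr.eval, hcost₄]
        simp only [Memory.setNat_nat_ne, ne_eq, Nat.reduceEqDiff, not_false_eq_true,
          Memory.setNat_real, hf, le_refl, true_and, forall_const]
        refine ⟨fun y hy hyp => ?_, ⟨ht0.congr hrow, ?_⟩, fun z hz => by rw [hold₇ z hz, hold z hz]⟩
        · rcases Nat.lt_succ_iff_lt_or_eq.mp hy with h | rfl
          · obtain ⟨h1, h2⟩ := hall y h hyp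
            rw [hcost₄] at htn
            rw [hb]
            exact (not_le.1 fun h3 => htn ⟨h1, h3⟩).le.trans h2
          · exact hb.le
        · rw [hb]
          exact Finset.sum_congr rfl fun l hl => by rw [hrow l (Finset.mem_range.1 hl)]
    · intro ht
      simp only [Test.eval, NExpr.eval, RExpr.eval, h21, h6, Nat.le_zero, hperm] at ht
      refine Ends.skip (by omega) ?_
      simp only [Memory.setNat_nat_ne, ne_eq, Nat.reduceEqDiff, not_false_eq_true,
          Memory.setNat_real, h21, h25, h6]
      refine ⟨fun y hy hyp => ?_, hfound, hold⟩
      rcases Nat.lt_succ_iff_lt_or_eq.mp hy with h | rfl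
      · exact hall y h hyp
      · by_contra hcon
        refine ht ⟨hyp, fun h => hcon ⟨h.1, ?_⟩⟩
        rw [← hcost₄]; exact h.2
  · rintro s₂ h₂ ⟨hall, hfound, hold⟩
    have hid : IsPerm k (fun l => l) := ⟨fun l hl => hl, fun a _ b hb => hb.ne'⟩
    -- every permutation has a code below `k ^ k ≤ R`
    have key : ∀ f, IsPerm k f → 1 ≤ s₂.nat 21 0 ∧
        s₂.real 6 0 ≤ ∑ l ∈ Finset.range k, w l (f l) := by
      intro f hf
      obtain ⟨x, hx, hxf⟩ := exists_digits hf.1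
      have h := hall x (hx.trans_le hR) (hf.congr hxf)
      rwa [Finset.sum_congr rfl fun l hl => by rw [hxf l (Finset.mem_range.1 hl)]] at h
    obtain ⟨h1, h2⟩ := hfound (key _ hid).1
    exact ⟨h1, h2, fun f hf => (key f hf).2, hold⟩

theorem ends_scoreProg (hE : Env n d k m R X W s) (hn : 1 ≤ n) (hd : 1 ≤ d) (hk : 1 ≤ k)
    (hR : k ^ k ≤ R) {ctr : ℕ → ℕ → ℝ}
    (hctr : ∀ j < k, ∀ c < d, s.real 3 (j * d + c) = ctr j c) :
    Ends scoreProg s (1600000000 * (n * (R * (k * (k * d))))) (fun s' =>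
      (∀ i < n, IsPerm k (fun l => s'.nat 25 (i * k + l))) ∧
      s'.real 7 0 = ∑ i ∈ Finset.range n, ∑ l ∈ Finset.range k,
        weight d k X ctr i l (s'.nat 25 (i * k + l)) ∧
      ∀ f : ℕ → ℕ → ℕ, (∀ i < n, IsPerm k (f i)) → s'.real 7 0 ≤
        ∑ i ∈ Finset.range n, ∑ l ∈ Finset.range k, weight d k X ctr i l (f i l)) := by
  have hR1 : 1 ≤ R := (Nat.one_le_pow _ _ hk).trans hR
  have hkkd : 1 ≤ k * (k * d) := Nat.mul_pos hk (Nat.mul_pos hk hd)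
  have e1 : k * (k * d) ≤ R * (k * (k * d)) := Nat.le_mul_of_pos_left _ hR1
  have e2 : R * (k * k) ≤ R * (k * (k * d)) := by
    rw [← mul_assoc k k d]; exact Nat.mul_le_mul_left _ (Nat.le_mul_of_pos_right _ hd)
  have e3 : 50 * (k * (50 * (k * (4000 * d)))) = 10000000 * (k * (k * d)) := by ring
  have e4 : 50 * (n * (31000000 * (R * (k * (k * d))))) =
    1550000000 * (n * (R * (k * (k * d)))) := by ring
  have e5 : 1 ≤ n * (R * (k * (k * d))) := Nat.mul_pos hn (by omega)
  refine Ends.seq (B₁ := 10) (B₂ := 50 * (n * (31000000 * (R * (k * (k * d))))))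
    (Q₁ := fun s' => s'.real 7 0 = 0)
    (Ends.setReal (by simp [NExpr.size, RExpr.size]) (by simp [NExpr.eval, RExpr.eval])) ?_
    (by omega)
  intro s₁ h₁ hz₁
  have hE₁ := hE.of_same h₁ (by decide)
  have hr₁ : s₁.real 3 = s.real 3 := h₁.real 3 rfl
  refine Ends.forLoop (fun i s' =>
    (∀ i' < i, IsPerm k (fun l => s'.nat 25 (i' * k + l)) ∧
      ∀ f, IsPerm k f → ∑ l ∈ Finset.range k, weight d k X ctr i' l (s'.nat 25 (i' * k + l)) ≤
        ∑ l ∈ Finset.range k, weight d k X ctr i' l (f l)) ∧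
    s'.real 7 0 = ∑ i' ∈ Finset.range i, ∑ l ∈ Finset.range k,
        weight d k X ctr i' l (s'.nat 25 (i' * k + l))) rfl
    (fun s' h => (hE₁.of_same h (by decide)).n_eq) (by simpa using hz₁) ?_ ?_
    (by simp [NExpr.size]) hn (by omega) le_rfl
  · rintro i hi s₂ h₂ hi₂ ⟨hrows, hsum⟩
    have hE₂ := hE₁.of_same h₂ (by decide)
    have hr₂ : s₂.real 3 = s.real 3 := by rw [h₂.real 3 rfl, hr₁]
    refine Ends.seq (B₁ := 50 * (k * (50 * (k * (4000 * d)))))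
      (B₂ := 20000000 * (R * (k * k)) + 30)
      (ends_weightsProg hE₂ hn hd hk hi hi₂ (by rw [hr₂]; exact hctr)) ?_ (by omega)
    intro s₃ h₃ hw₃
    have hE₃ := hE₂.of_same h₃ (by decide)
    have hi₃ : s₃.nat 14 0 = i := by rw [h₃.nat 14 rfl, hi₂]
    refine Ends.seq (B₁ := 20000000 * (R * (k * k))) (B₂ := 20)
      (ends_assignProg hE₃ hk hR hi hi₃ hw₃) ?_ (by omega)
    rintro s₄ h₄ ⟨hp, hb, hmin, hold⟩
    refine Ends.setReal (by simp [NExpr.size, RExpr.size]) ?_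
    have h7 : s₄.real 7 = s₂.real 7 := by rw [h₄.real 7 rfl, h₃.real 7 rfl]
    have hsame : ∀ i' < i, ∀ l < k, s₄.nat 25 (i' * k + l) = s₂.nat 25 (i' * k + l) := by
      intro i' hi' l hl
      have : (i' + 1) * k ≤ i * k := Nat.mul_le_mul_right _ hi'
      rw [Nat.succ_mul] at this
      rw [hold _ (by omega), h₃.nat 25 rfl]
    simp only [Memory.setNat_nat_ne, ne_eq, Nat.reduceEqDiff, not_false_eq_true,
      Memory.setNat_real, Memory.setReal_nat, Memory.setReal_real_same, RExpr.eval, NExpr.eval,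
      Function.update_self, h7, hsum, hb]
    constructor
    · intro i' hi'
      rcases Nat.lt_succ_iff_lt_or_eq.mp hi' with h | rfl
      · have hrow : ∑ l ∈ Finset.range k, weight d k X ctr i' l (s₄.nat 25 (i' * k + l)) =
            ∑ l ∈ Finset.range k, weight d k X ctr i' l (s₂.nat 25 (i' * k + l)) :=
          Finset.sum_congr rfl fun l hl => by rw [hsame i' h l (Finset.mem_range.1 hl)]
        rw [hrow]
        exact ⟨(hrows i' h).1.congr (hsame i' h), (hrows i' h).2⟩
      · exact ⟨hp, fun f hf => by rw [← hb]; exact hmin f hf⟩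
    · rw [Finset.sum_range_succ]
      congr 1
      refine Finset.sum_congr rfl fun i' hi' => Finset.sum_congr rfl fun l hl => ?_
      rw [hsame i' (Finset.mem_range.1 hi') l (Finset.mem_range.1 hl)]
  · rintro s₂ h₂ ⟨hrows, hsum⟩
    refine ⟨fun i hi => (hrows i hi).1, hsum, fun f hf => ?_⟩
    rw [hsum]
    exact Finset.sum_le_sum fun i hi =>
      (hrows i (Finset.mem_range.1 hi)).2 _ (hf i (Finset.mem_range.1 hi))

theorem ends_recordProg (hE : Env n d k m R X W s) (hn : 1 ≤ n) (hd : 1 ≤ d) (hk : 1 ≤ k) :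
    Ends recordProg s (300000 * (n * (k * d))) (fun s' =>
      (∀ j < k, ∀ c < d, s'.real 2 (j * d + c) = s.real 3 (j * d + c)) ∧
      (∀ i < n, ∀ l < k, s'.nat 1 (i * k + l) = s.nat 25 (i * k + l)) ∧
      s'.nat 23 0 = 1 ∧ s'.real 8 0 = s.real 7 0) := by
  have e1 : k * d ≤ n * (k * d) := Nat.le_mul_of_pos_left _ hn
  have e2 : n * k ≤ n * (k * d) := Nat.mul_le_mul_left _ (Nat.le_mul_of_pos_right _ hd)
  have e3 : 1 ≤ n * k := Nat.mul_pos hn hk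
  have e4 : 50 * (k * (50 * (d * 30))) = 75000 * (k * d) := by ring
  have e5 : 50 * (n * (50 * (k * 30))) = 75000 * (n * k) := by ring
  refine Ends.seq (B₁ := 10) (B₂ := 200000 * (n * (k * d)))
    (Ends.setNat (Q := fun s' => s' = _) (by simp [NExpr.size]) rfl) ?_ (by omega)
  rintro s₁ h₁ rfl
  refine Ends.seq (B₁ := 10) (B₂ := 190000 * (n * (k * d)))
    (Ends.setReal (Q := fun s' => s' = _) (by simp [NExpr.size, RExpr.size]) rfl) ?_ (by omega)
  rintro s₂ h₂ rfl
  set s₂ := (s.setNat 23 ((NExpr.lit 0).eval s) ((NExpr.lit 1).eval s)).setReal 8 _ _ with hs₂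
  have hE₂ := (hE.of_same h₁ (by decide)).of_same h₂ (by decide)
  refine Ends.seq (B₁ := 50 * (k * (50 * (d * 30)))) (B₂ := 50 * (n * (50 * (k * 30))))
    (Ends.fillLoop₂ (fun s => s.real 2) (fun j c => s.real 3 (j * d + c)) (D := d) (L := k)
      rfl rfl (by norm_num)
      (fun _ _ => rfl) (fun _ _ => rfl) (fun s' h => ?_) ?_ (by simp [NExpr.size])
      (by simp [NExpr.size]) hk hd (by norm_num)) ?_ (by omega)
  · have hE₃ := hE₂.of_same h (by decide)
    exact ⟨hE₃.k_eq, hE₃.d_eq⟩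
  · intro j hj c hc s₃ h₃ hj₃ hc₃
    have hE₃ := hE₂.of_same h₃ (by decide)
    have h3 : s₃.real 3 = s.real 3 := by rw [h₃.real 3 rfl, h₂.real 3 rfl, h₁.real 3 rfl]
    have hjn : j ≤ n * k := hj.le.trans (Nat.le_mul_of_pos_left _ hn)
    refine Ends.setReal (by simp [NExpr.size, RExpr.size]) ?_
    simp only [NExpr.eval, RExpr.eval, hj₃, hc₃, hE₃.mul_d _ hjn, h3, Memory.setReal_real_same]
  intro s₃ h₃ hout
  have hE₃ := hE₂.of_same h₃ (by decide)
  refine (Ends.fillLoop₂ (fun s => s.nat 1) (fun i l => s.nat 25 (i * k + l)) (D := k) (L := n)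
      (B₁ := 30) rfl rfl (by norm_num)
      (fun _ _ => by simp) (fun _ _ => by simp) (fun s' h => ?_) ?_ (by simp [NExpr.size])
      (by simp [NExpr.size]) hn hk (by norm_num)).mono le_rfl ?_
  · have hE₄ := hE₃.of_same h (by decide)
    exact ⟨hE₄.n_eq, hE₄.k_eq⟩
  · intro i hi l hl s₄ h₄ hi₄ hl₄
    have hE₄ := hE₃.of_same h₄ (by decide)
    have h25 : s₄.nat 25 = s.nat 25 := by
      rw [h₄.nat 25 rfl, h₃.nat 25 rfl, h₂.nat 25 rfl, h₁.nat 25 rfl]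
    refine Ends.setNat (by simp [NExpr.size]) ?_
    simp only [NExpr.eval, hi₄, hl₄, hE₄.mul_k i (by omega), h25, Memory.setNat_nat_same]
  · intro s₄ h₄ hcl
    refine ⟨fun j hj c hc => by rw [h₄.real 2 rfl, hout j hj c hc], hcl, ?_, ?_⟩
    · rw [h₄.nat 23 rfl, h₃.nat 23 rfl]; simp [hs₂, NExpr.eval]
    · rw [h₄.real 8 rfl, h₃.real 8 rfl]; simp [hs₂, RExpr.eval, NExpr.eval]

/-- The output is the centers of some trial `t` together with assignments `f i` of the point-sets,
and no trial and no assignments have smaller total cost. -/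
def IsBestTrial (n d k m R : ℕ) (X : ℕ → ℝ) (W : ℕ → ℕ) (s : Memory) : Prop :=
  ∃ t < R, ∃ f : ℕ → ℕ → ℕ, (∀ i < n, IsPerm k (f i)) ∧
    (∀ j < k, ∀ c < d, s.real 2 (j * d + c) = trialCenter d k m X W t j c) ∧
    (∀ i < n, ∀ l < k, s.nat 1 (i * k + l) = f i l) ∧
    ∀ t' < R, ∀ f' : ℕ → ℕ → ℕ, (∀ i < n, IsPerm k (f' i)) →
      ∑ i ∈ Finset.range n, ∑ l ∈ Finset.range k,
        weight d k X (trialCenter d k m X W t) i l (f i l) ≤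
      ∑ i ∈ Finset.range n, ∑ l ∈ Finset.range k,
        weight d k X (trialCenter d k m X W t') i l (f' i l)

theorem ends_trialsProg (hE : Env n d k m R X W s) (hW : ∀ x < R * k * m, W x < n * k)
    (hn : 1 ≤ n) (hd : 1 ≤ d) (hk : 1 ≤ k) (hm : 1 ≤ m) (hR : k ^ k ≤ R) :
    Ends trialsProg s (100000000000 * (R * (n * (R * (k * (k * (d * m)))))))
      (IsBestTrial n d k m R X W) := by
  have hR1 : 1 ≤ R := (Nat.one_le_pow _ _ hk).trans hR
  have a1 : 1 ≤ k * d := Nat.mul_pos hk hd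
  have a2 : k * d ≤ k * (k * d) := Nat.le_mul_of_pos_left _ hk
  have b1 : k * (d * m) ≤ k * (k * (d * m)) := Nat.le_mul_of_pos_left _ hk
  have b2 : k * (k * (d * m)) ≤ R * (k * (k * (d * m))) := Nat.le_mul_of_pos_left _ hR1
  have b3 : R * (k * (k * (d * m))) ≤ n * (R * (k * (k * (d * m)))) := Nat.le_mul_of_pos_left _ hn
  have c1 : n * (R * (k * (k * d))) ≤ n * (R * (k * (k * (d * m)))) := by
    gcongr; exact Nat.le_mul_of_pos_right _ hm
  have c2 : n * (k * d) ≤ n * (R * (k * (k * d))) :=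
    Nat.mul_le_mul_left _ (a2.trans (Nat.le_mul_of_pos_left _ hR1))
  have c3 : 1 ≤ n * (k * d) := Nat.mul_pos hn a1
  have e1 : 50 * (k * (50 * (d * (4000 * m)))) = 10000000 * (k * (d * m)) := by ring
  have e2 : 50 * (R * (1700000000 * (n * (R * (k * (k * (d * m))))))) =
    85000000000 * (R * (n * (R * (k * (k * (d * m)))))) := by ring
  have e3 : 1 ≤ R * (n * (R * (k * (k * (d * m))))) := Nat.mul_pos hR1 (by omega)
  refine Ends.seq (B₁ := 10) (B₂ := 50 * (R * (1700000000 * (n * (R * (k * (k * (d * m))))))))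
    (Q₁ := fun s' => s'.nat 23 0 = 0)
    (Ends.setNat (by simp [NExpr.size]) (by simp [NExpr.eval])) ?_ (by omega)
  intro s₁ h₁ hz₁
  have hE₁ := hE.of_same h₁ (by decide)
  refine Ends.forLoop (fun t s' =>
    (∀ t' < t, ∀ f' : ℕ → ℕ → ℕ, (∀ i < n, IsPerm k (f' i)) → 1 ≤ s'.nat 23 0 ∧ s'.real 8 0 ≤
      ∑ i ∈ Finset.range n, ∑ l ∈ Finset.range k,
        weight d k X (trialCenter d k m X W t') i l (f' i l)) ∧
    (1 ≤ s'.nat 23 0 → ∃ t' < t, ∃ f : ℕ → ℕ → ℕ, (∀ i < n, IsPerm k (f i)) ∧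
      (∀ j < k, ∀ c < d, s'.real 2 (j * d + c) = trialCenter d k m X W t' j c) ∧
      (∀ i < n, ∀ l < k, s'.nat 1 (i * k + l) = f i l) ∧
      s'.real 8 0 = ∑ i ∈ Finset.range n, ∑ l ∈ Finset.range k,
        weight d k X (trialCenter d k m X W t') i l (f i l))) rfl
    (fun s' h => (hE₁.of_same h (by decide)).r_eq) (by simp [hz₁]) ?_ ?_
    (by simp [NExpr.size]) hR1 (by omega) le_rfl
  · rintro t ht s₂ h₂ ht₂ ⟨hall, hfound⟩
    have hE₂ := hE₁.of_same h₂ (by decide)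
    refine Ends.seq (B₁ := 50 * (k * (50 * (d * (4000 * m)))))
      (B₂ := 1600000000 * (n * (R * (k * (k * d)))) + 300000 * (n * (k * d)) + 30)
      (ends_centersProg hE₂ hW hn hd hk hm ht ht₂) ?_ (by omega)
    intro s₃ h₃ hctr
    have hE₃ := hE₂.of_same h₃ (by decide)
    refine Ends.seq (B₁ := 1600000000 * (n * (R * (k * (k * d)))))
      (B₂ := 300000 * (n * (k * d)) + 20) (ends_scoreProg hE₃ hn hd hk hR hctr) ?_ (by omega)
    rintro s₄ h₄ ⟨hp, hb, hmin⟩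
    have hE₄ := hE₃.of_same h₄ (by decide)
    have h23 : s₄.nat 23 = s₂.nat 23 := by rw [h₄.nat 23 rfl, h₃.nat 23 rfl]
    have h8 : s₄.real 8 = s₂.real 8 := by rw [h₄.real 8 rfl, h₃.real 8 rfl]
    refine Ends.ite (B₁ := 300000 * (n * (k * d))) ?_ ?_
      (by simp [Test.size, NExpr.size, RExpr.size])
    · intro htest
      simp only [Test.eval, NExpr.eval, RExpr.eval, h23, h8] at htest
      refine (ends_recordProg hE₄ hn hd hk).mono le_rfl ?_
      rintro s₅ h₅ ⟨hout, hcl, hf, hbest⟩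
      simp only [Memory.setNat_nat_ne, ne_eq, Nat.reduceEqDiff, not_false_eq_true,
        Memory.setNat_real, hf, le_refl, true_and, forall_const, hbest, OfNat.one_ne_ofNat]
      refine ⟨fun t' ht' f' hf' => ?_, t, by omega, fun i l => s₄.nat 25 (i * k + l), hp,
        fun j hj c hc => ?_, hcl, hb⟩
      · rcases Nat.lt_succ_iff_lt_or_eq.mp ht' with h | rfl
        · obtain ⟨g1, g2⟩ := hall t' h f' hf'
          exact (not_le.1 fun g3 => htest ⟨g1, g3⟩).le.trans g2
        · exact hmin f' hf'
      · rw [hout j hj c hc, h₄.real 3 rfl, hctr j hj c hc]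
    · intro htest
      simp only [Test.eval, NExpr.eval, RExpr.eval, h23, h8, not_not] at htest
      refine Ends.skip (by omega) ?_
      have h2 : s₄.real 2 = s₂.real 2 := by rw [h₄.real 2 rfl, h₃.real 2 rfl]
      have h1 : s₄.nat 1 = s₂.nat 1 := by rw [h₄.nat 1 rfl, h₃.nat 1 rfl]
      simp only [Memory.setNat_nat_ne, ne_eq, Nat.reduceEqDiff, not_false_eq_true,
        Memory.setNat_real, h23, h8, h2, h1, OfNat.one_ne_ofNat]
      refine ⟨fun t' ht' f' hf' => ?_, fun h => ?_⟩
      · rcases Nat.lt_succ_iff_lt_or_eq.mp ht' with h | rfl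
        · exact hall t' h f' hf'
        · exact ⟨htest.1, htest.2.trans (hmin f' hf')⟩
      · obtain ⟨t', ht', rest⟩ := hfound h
        exact ⟨t', by omega, rest⟩
  · rintro s₂ h₂ ⟨hall, hfound⟩
    -- some solution has been recorded, as there are a trial and permutations to compare with
    have hid : ∀ i < n, IsPerm k ((fun _ l => l : ℕ → ℕ → ℕ) i) := fun i _ =>
      ⟨fun l hl => hl, fun a _ b hb => hb.ne'⟩
    obtain ⟨t, ht, f, hf, hc, hcl, hbest⟩ := hfound (hall 0 hR1 _ hid).1
    exact ⟨t, ht, f, hf, hc, hcl, fun t' ht' f' hf' => by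
      rw [← hbest]; exact (hall t' ht' f' hf').2⟩

end

end ChromaticClustering

namespace RealRAM

/-! ### Uniform distributions -/

/-- Independent uniform choices from `α` and `β` amount to a uniform choice from `α × β`. -/
theorem uniformOfFintype_bind_map_equiv {α β γ : Type} [Fintype α] [Nonempty α] [Fintype β]
    [Nonempty β] [Fintype γ] [Nonempty γ] (e : α × β ≃ γ) :
    ((PMF.uniformOfFintype α).bind fun a => (PMF.uniformOfFintype β).map fun b => e (a, b)) =
      PMF.uniformOfFintype γ := by
  classical
  ext c
  obtain ⟨⟨a₀, b₀⟩, rfl⟩ := e.surjective c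
  simp only [PMF.bind_apply, PMF.map_apply, tsum_fintype, PMF.uniformOfFintype_apply,
    e.apply_eq_iff_eq, Prod.mk.injEq]
  rw [Fintype.sum_eq_single a₀, Fintype.sum_eq_single b₀, ← Fintype.card_congr e,
    Fintype.card_prod, Nat.cast_mul, ENNReal.mul_inv (by simp) (by simp)]
  · simp
  · intro b hb; simp [hb.symm]
  · intro a ha; simp [ha.symm]

theorem uniformBelow_eq (M : ℕ) [NeZero M] :
    uniformBelow M = (PMF.uniformOfFintype (Fin M)).map Fin.val := by
  obtain ⟨M, rfl⟩ := Nat.exists_eq_succ_of_ne_zero (NeZero.ne M)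
  rfl

/-- The array that arises from `w` when the cells `0, …, N - 1` are overwritten with `ω`. -/
def overwrite {M N : ℕ} (w : ℕ → ℕ) (ω : Fin N → Fin M) : ℕ → ℕ :=
  fun i => if h : i < N then ω ⟨i, h⟩ else w i

theorem tape_eq (M : ℕ) [NeZero M] (w : ℕ → ℕ) (N : ℕ) :
    tape M w N = (PMF.uniformOfFintype (Fin N → Fin M)).map (overwrite w) := by
  induction N with
  | zero =>
    have : (overwrite w : (Fin 0 → Fin M) → ℕ → ℕ) = fun _ => w := by
      funext ω i; simp [overwrite]
    rw [this, tape]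
    exact (PMF.map_const _ _).symm
  | succ N ih =>
    rw [tape, ih, PMF.bind_map,
      ← uniformOfFintype_bind_map_equiv ((Equiv.prodComm _ _).trans (Fin.snocEquiv fun _ => Fin M)),
      PMF.map_bind]
    congr 1
    funext ω
    simp only [Function.comp_apply, uniformBelow_eq, PMF.map_comp]
    congr 1
    funext a i
    simp only [Function.comp_apply, Equiv.trans_apply, Equiv.prodComm_apply, Prod.swap,
      overwrite, Function.update_apply, Fin.snocEquiv_apply, Fin.snoc]
    rcases lt_trichotomy i N with h | rfl | h
    · simp [h, h.ne, h.trans (Nat.lt_succ_self N)]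
    · simp
    · simp [h.ne', h.not_gt, show ¬ i < N + 1 by omega]

end RealRAM

namespace ChromaticClustering

open RealRAM

/-! ### The distribution of the outcome -/

section

variable {n d k m R : ℕ} {X : ℕ → ℝ} {s : Memory}

theorem ends_sampleSizeProg {ε : ℝ} (hε : 0 < ε) (hs : s.nat 2 0 = 0) (hsε : s.real 0 0 = ε) :
    Ends sampleSizeProg s (100 * ⌈2 / ε⌉₊) (fun s' => s'.nat 2 0 = ⌈2 / ε⌉₊) := by
  have htest : ∀ (s' : Memory) (i : ℕ), s'.real 0 0 = ε → s'.nat 2 0 = i →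
      ((Test.neg (.realLe (.ofNat (.lit 2)) (.times (.ofNat mVar) (.get 0 (.lit 0))))).eval s' ↔
        i < ⌈2 / ε⌉₊) := by
    intro s' i h1 h2
    simp only [Test.eval, RExpr.eval, NExpr.eval, h1, h2, Nat.lt_ceil, not_le, Nat.cast_ofNat]
    rw [lt_div_iff₀ hε]
  have hpos : 1 ≤ ⌈2 / ε⌉₊ := Nat.one_le_ceil_iff.2 (by positivity)
  refine Ends.loop (L := ⌈2 / ε⌉₊) (B₁ := 10) (fun i s' => s'.nat 2 0 = i) hs ?_ ?_ (by
    simp [Test.size, NExpr.size, RExpr.size]; omega)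
  · intro i hi s' h hI
    refine ⟨(htest s' i (by rw [h.real 0 rfl, hsε]) hI).2 hi, Ends.setNat (by simp [NExpr.size]) ?_⟩
    simp [NExpr.eval, hI]
  · intro s' h hI
    exact ⟨fun hb => lt_irrefl _ ((htest s' _ (by rw [h.real 0 rfl, hsε]) hI).1 hb), hI⟩

theorem ends_trialCountProg (hk : 1 ≤ k) (hm : 1 ≤ m) (hsk : s.nat 0 2 = k) (hsm : s.nat 2 0 = m) :
    Ends trialCountProg s (2000000 * (k * (k * m))) (fun s' => s'.nat 3 0 = 2 ^ (k * k * m)) := by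
  have e1 : 50 * (k * (50 * (k * (50 * (m * 10))))) = 1250000 * (k * (k * m)) := by ring
  have e2 : 1 ≤ k * (k * m) := Nat.mul_pos hk (Nat.mul_pos hk hm)
  refine Ends.seq (B₁ := 10) (B₂ := 50 * (k * (50 * (k * (50 * (m * 10))))))
    (Q₁ := fun s' => s'.nat 3 0 = 1)
    (Ends.setNat (by simp [NExpr.size]) (by simp [NExpr.eval])) ?_ (by omega)
  intro s₁ h₁ hz₁
  have hk₁ : s₁.nat 0 2 = k := by rw [h₁.nat 0 rfl, hsk]
  have hm₁ : s₁.nat 2 0 = m := by rw [h₁.nat 2 rfl, hsm]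
  have hkm : 1 ≤ k * (50 * (m * 10)) := Nat.mul_pos hk (by omega)
  refine Ends.forLoop (fun a s' => s'.nat 3 0 = 2 ^ (a * k * m)) rfl
    (fun s' h => by simp [NExpr.eval, h.nat 0 rfl, hk₁]) (by simp [hz₁]) ?_ (fun s' _ h => h)
    (by simp [NExpr.size]) hk (by omega) le_rfl
  intro a ha s₂ h₂ ha₂ hI₂
  have hk₂ : s₂.nat 0 2 = k := by rw [h₂.nat 0 rfl, hk₁]
  have hm₂ : s₂.nat 2 0 = m := by rw [h₂.nat 2 rfl, hm₁]
  refine Ends.forLoop (fun b s' => s'.nat 3 0 = 2 ^ ((a * k + b) * m)) rfl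
    (fun s' h => by simp [NExpr.eval, h.nat 0 rfl, hk₂]) (by simp [hI₂]) ?_ (fun s' _ h => by
      simp [h, Nat.succ_mul])
    (by simp [NExpr.size]) hk (by omega) le_rfl
  intro b hb s₃ h₃ hb₃ hI₃
  have hm₃ : s₃.nat 2 0 = m := by rw [h₃.nat 2 rfl, hm₂]
  refine Ends.forLoop (fun c s' => s'.nat 3 0 = 2 ^ ((a * k + b) * m + c)) rfl
    (fun s' h => by simp [NExpr.eval, h.nat 2 rfl, hm₃]) (by simp [hI₃]) ?_ (fun s' _ h => by
      simp [h, ← Nat.add_assoc, Nat.succ_mul])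
    (by simp [NExpr.size]) hm (by omega) le_rfl
  intro c hc s₄ h₄ hc₄ hI₄
  refine Ends.setNat (by simp [NExpr.size]) ?_
  simp only [NExpr.eval, hI₄, ne_eq, Nat.reduceEqDiff, not_false_eq_true, Memory.setNat_nat_ne,
    Memory.setNat_nat_same, Function.update_self]
  rw [← Nat.add_assoc, pow_succ]; omega

theorem ends_setupProg {ε : ℝ} (hε : 0 < ε) (hn : 1 ≤ n) (hk : 1 ≤ k)
    (hm : m = ⌈2 / ε⌉₊) (hR : R = 2 ^ (k * k * m))
    (hs : s.nat 0 0 = n ∧ s.nat 0 1 = d ∧ s.nat 0 2 = k) (hs2 : s.nat 2 0 = 0)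
    (hsε : s.real 0 0 = ε) (hX : s.real 1 = X) :
    Ends setupProg s (3000000 * (n * (R * (k * (k * m))))) (Env n d k m R X (s.nat 7)) := by
  have hm1 : 1 ≤ m := by rw [hm]; exact Nat.one_le_ceil_iff.2 (by positivity)
  have hR1 : 1 ≤ R := by rw [hR]; exact Nat.one_le_two_pow
  set Z := n * (R * (k * (k * m))) with hZ
  have hZ0 : 0 < Z := by positivity
  have z1 : m ≤ Z := Nat.le_of_dvd hZ0 ⟨n * R * k * k, by rw [hZ]; ring⟩
  have z2 : k * (k * m) ≤ Z := Nat.le_of_dvd hZ0 ⟨n * R, by rw [hZ]; ring⟩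
  have z3 : n ≤ Z := Nat.le_of_dvd hZ0 ⟨R * k * k * m, by rw [hZ]; ring⟩
  have z4 : k ≤ Z := Nat.le_of_dvd hZ0 ⟨n * R * k * m, by rw [hZ]; ring⟩
  have z5 : R ≤ Z := Nat.le_of_dvd hZ0 ⟨n * k * k * m, by rw [hZ]; ring⟩
  have z6 : n * k ≤ Z := Nat.le_of_dvd hZ0 ⟨R * k * m, by rw [hZ]; ring⟩
  have z7 : R * k ≤ Z := Nat.le_of_dvd hZ0 ⟨n * k * m, by rw [hZ]; ring⟩
  refine Ends.seq (B₁ := 100 * m) (B₂ := 2500000 * Z) (by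
    have := ends_sampleSizeProg (s := s) hε hs2 hsε
    rwa [← hm] at this) ?_ (by omega)
  intro s₁ h₁ hm₁
  have g₁ : s₁.nat 0 = s.nat 0 := h₁.nat 0 rfl
  refine Ends.seq (B₁ := 2000000 * (k * (k * m))) (B₂ := 400000 * Z)
    (ends_trialCountProg hk hm1 (by rw [g₁, hs.2.2]) hm₁) ?_ (by omega)
  intro s₂ h₂ hR₂
  rw [← hR] at hR₂
  have g₂ : s₂.nat 0 = s.nat 0 := by rw [h₂.nat 0 rfl, g₁]
  refine Ends.seq (B₁ := 2000 * (n + (k + R))) (B₂ := 20000 * Z)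
    (Ends.table (L := n + (k + R)) (β := k) (by norm_num) (fun s' h => ?_) (by simp [NExpr.size])
      (by simp [NExpr.size]) (by omega)) ?_ (by omega)
  · simp [NExpr.eval, h.nat 0 rfl, h.nat 3 rfl, g₂, hs, hR₂]
  intro s₃ h₃ t₃
  have g₃ : s₃.nat 0 = s.nat 0 := by rw [h₃.nat 0 rfl, g₂]
  refine Ends.seq (B₁ := 2000 * (n * k)) (B₂ := 10000 * Z)
    (Ends.table (L := n * k) (β := d) (by norm_num) (fun s' h => ?_) (by simp [NExpr.size])
      (by simp [NExpr.size]) (Nat.mul_pos hn hk)) ?_ (by omega)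
  · simp [NExpr.eval, h.nat 0 rfl, h.nat 4 rfl, g₃, hs, t₃ n (by omega)]
  intro s₄ h₄ t₄
  have g₄ : s₄.nat 0 = s.nat 0 := by rw [h₄.nat 0 rfl, g₃]
  have m₄ : s₄.nat 2 0 = m := by rw [h₄.nat 2 rfl, h₃.nat 2 rfl, h₂.nat 2 rfl, hm₁]
  have r₄ : s₄.nat 3 0 = R := by rw [h₄.nat 3 rfl, h₃.nat 3 rfl, hR₂]
  have k₄ : s₄.nat 4 = s₃.nat 4 := h₄.nat 4 rfl
  refine Ends.seq (B₁ := 2000 * (R * k)) (B₂ := 4000 * R)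
    (Ends.table (L := R * k) (β := m) (by norm_num) (fun s' h => ?_) (by simp [NExpr.size])
      (by simp [NExpr.size]) (Nat.mul_pos hR1 hk)) ?_ (by omega)
  · simp [NExpr.eval, h.nat 2 rfl, h.nat 3 rfl, h.nat 4 rfl, r₄, m₄, k₄, t₃ R (by omega)]
  intro s₅ h₅ t₅
  have g₅ : s₅.nat 0 = s.nat 0 := by rw [h₅.nat 0 rfl, g₄]
  have r₅ : s₅.nat 3 0 = R := by rw [h₅.nat 3 rfl, r₄]
  refine (Ends.divModTable (L := R) (β := k) (fun s' h => ?_) (by simp [NExpr.size])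
    (by simp [NExpr.size]) hR1 hk).mono le_rfl ?_
  · simp [NExpr.eval, h.nat 0 rfl, h.nat 3 rfl, r₅, g₅, hs]
  intro s₆ h₆ t₆
  have g₆ : s₆.nat 0 = s.nat 0 := by rw [h₆.nat 0 rfl, g₅]
  exact
    { n_eq := by rw [g₆, hs.1]
      d_eq := by rw [g₆, hs.2.1]
      k_eq := by rw [g₆, hs.2.2]
      m_eq := by rw [h₆.nat 2 rfl, h₅.nat 2 rfl, m₄]
      r_eq := by rw [h₆.nat 3 rfl, r₅]
      mul_k := by rw [h₆.nat 4 rfl, h₅.nat 4 rfl, k₄]; exact t₃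
      mul_d := by rw [h₆.nat 5 rfl, h₅.nat 5 rfl]; exact t₄
      mul_m := by rw [h₆.nat 6 rfl]; exact t₅
      tape := by
        rw [h₆.nat 7 rfl, h₅.nat 7 rfl, h₄.nat 7 rfl, h₃.nat 7 rfl, h₂.nat 7 rfl, h₁.nat 7 rfl]
      div_mod := t₆
      points := by
        rw [h₆.real 1 rfl, h₅.real 1 rfl, h₄.real 1 rfl, h₃.real 1 rfl, h₂.real 1 rfl,
          h₁.real 1 rfl, hX] }

/-- The algorithm halts, and the outcome is a function `g` of the uniformly random tape `ω`: the best
solution of all trials. -/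
theorem exists_run_mainProg {ε : ℝ} (hε : 0 < ε) (hn : 1 ≤ n) (hd : 1 ≤ d) (hk : 1 ≤ k)
    (hm : m = ⌈2 / ε⌉₊) (hR : R = 2 ^ (k * k * m))
    (hs : s.nat 0 0 = n ∧ s.nat 0 1 = d ∧ s.nat 0 2 = k) (hs2 : s.nat 2 0 = 0)
    (hsε : s.real 0 0 = ε) (hX : s.real 1 = X) [NeZero (n * k)] {T : ℕ}
    (hT : 200000000000 * (R * (n * (R * (k * (k * (d * m)))))) ≤ T) :
    ∃ g : (Fin (R * k * m) → Fin (n * k)) → Configuration,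
      run mainProg s T = (PMF.uniformOfFintype (Fin (R * k * m) → Fin (n * k))).map g ∧
      ∀ ω, (g ω).todo = [] ∧ (g ω).time ≤ T ∧
        IsBestTrial n d k m R X (overwrite (s.nat 7) ω) (g ω).mem := by
  have hm1 : 1 ≤ m := by rw [hm]; exact Nat.one_le_ceil_iff.2 (by positivity)
  have hR1 : 1 ≤ R := by rw [hR]; exact Nat.one_le_two_pow
  have hkR : k ^ k ≤ R := by
    calc k ^ k ≤ (2 ^ k) ^ k := Nat.pow_le_pow_left Nat.lt_two_pow_self.le _
      _ = 2 ^ (k * k) := by rw [pow_mul]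
      _ ≤ R := by
        rw [hR]; exact Nat.pow_le_pow_right (by norm_num) (Nat.le_mul_of_pos_right _ hm1)
  set Z := R * (n * (R * (k * (k * (d * m))))) with hZ
  have hZ0 : 0 < Z := by positivity
  have z1 : n * (R * (k * (k * m))) ≤ Z := Nat.le_of_dvd hZ0 ⟨R * d, by rw [hZ]; ring⟩
  have z2 : R * k * m ≤ Z := Nat.le_of_dvd hZ0 ⟨n * R * k * d, by rw [hZ]; ring⟩
  obtain ⟨s₁, N₁, t₁, a1, a2, -, hE, a5⟩ := ends_setupProg hε hn hk hm hR hs hs2 hsε hX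
  have hlim : ∀ w c, (NExpr.get 6 (.get 4 rVar)).eval ((s₁.setNat 10 0 c).withNat 7 w) =
      R * k * m := by
    intro w c
    simp [NExpr.eval, Memory.withNat, hE.r_eq, hE.mul_k R (by omega), hE.mul_m _ le_rfl]
  have hmax : ∀ w c, (NExpr.get 4 nVar).eval ((s₁.setNat 10 0 c).withNat 7 w) = n * k := by
    intro w c
    simp [NExpr.eval, Memory.withNat, hE.n_eq, hE.mul_k n (by omega)]
  have hsample := steps_forLoop_rand (a := 7) (v := 10) (by norm_num) s₁ hlim hmax
  set L := R * k * m with hL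
  set t₂ := L * ((NExpr.get 4 nVar).size + (NExpr.get 6 (.get 4 rVar)).size + 16) +
    (NExpr.get 6 (.get 4 rVar)).size + 10 with ht₂
  have ht₂' : t₂ ≤ 40 * Z := by
    have : t₂ = L * 23 + 14 := by simp [ht₂, NExpr.size]
    omega
  have ht₂'' : 4 * L + 3 ≤ t₂ := by
    have : t₂ = L * 23 + 14 := by simp [ht₂, NExpr.size]
    omega
  have htrial : ∀ ω : Fin L → Fin (n * k), Ends trialsProg
      ((s₁.setNat 10 0 L).withNat 7 (overwrite (s.nat 7) ω))
      (100000000000 * Z) (IsBestTrial n d k m R X (overwrite (s.nat 7) ω)) := by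
    intro ω
    refine ends_trialsProg ?_ (fun x hx => ?_) hn hd hk hm1 hkR
    · constructor <;> simp [Memory.withNat, hE.n_eq, hE.d_eq, hE.k_eq, hE.m_eq, hE.r_eq, hE.points]
      exacts [hE.mul_k, hE.mul_d, hE.mul_m, hE.div_mod]
    · rw [overwrite, dif_pos hx]
      exact (ω _).2
  choose s₃ N₃ t₃ b1 b2 _ b4 b5 using htrial
  refine ⟨fun ω => ⟨[], s₃ ω, 0 + 1 + t₁ + 1 + t₂ + t₃ ω⟩, ?_, fun ω => ⟨rfl, ?_, b4 ω⟩⟩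
  · -- the two sequencing steps, the setup and the drawing; the rest is left to the trials
    have hTN : T = (N₁ + ((4 * L + 3 + (T - (N₁ + (4 * L + 3) + 2))) + 1)) + 1 := by omega
    rw [run, hTN, steps_succ, mainProg, step, PMF.pure_bind, a5, steps_succ, step, PMF.pure_bind,
      samplingProg, hsample, hE.tape, tape_eq, PMF.bind_map, ← PMF.bind_pure_comp]
    congr 1
    funext ω
    simp only [Function.comp_apply]
    have hN : T - (N₁ + (4 * L + 3) + 2) = N₃ ω + (T - (N₁ + (4 * L + 3) + 2) - N₃ ω) := by
      have := b1 ω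
      have := b2 ω
      omega
    rw [hN, b5, steps_halted]
  · have := b2 ω
    change 0 + 1 + t₁ + 1 + t₂ + t₃ ω ≤ T
    omega

end

/-! ### Means of random samples -/

section

variable {E : Type*} [NormedAddCommGroup E] [InnerProductSpace ℝ E]

/-- The mean of finitely many points. -/
noncomputable def mean {n : ℕ} (y : Fin n → E) : E := (n : ℝ)⁻¹ • ∑ i, y i

theorem sum_sub_mean {n : ℕ} (hn : 1 ≤ n) (y : Fin n → E) : ∑ i, (y i - mean y) = 0 := by
  have : (n : ℝ) ≠ 0 := by positivity
  rw [Finset.sum_sub_distrib, Finset.sum_const, Finset.card_univ, Fintype.card_fin, mean,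
    ← Nat.cast_smul_eq_nsmul ℝ, smul_smul, mul_inv_cancel₀ this, one_smul, sub_self]

/-- The sum of squared distances to a point `c` exceeds that to the mean by `n * ‖mean y - c‖ ^ 2`. -/
theorem sum_norm_sub_sq {n : ℕ} (hn : 1 ≤ n) (y : Fin n → E) (c : E) :
    ∑ i, ‖y i - c‖ ^ 2 = ∑ i, ‖y i - mean y‖ ^ 2 + n * ‖c - mean y‖ ^ 2 := by
  have h : ∀ i, ‖y i - c‖ ^ 2 =
      ‖y i - mean y‖ ^ 2 - 2 * inner ℝ (y i - mean y) (c - mean y) + ‖c - mean y‖ ^ 2 := by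
    intro i
    rw [← norm_sub_sq_real, sub_sub_sub_cancel_right]
  simp only [h, Finset.sum_add_distrib, Finset.sum_sub_distrib, ← Finset.mul_sum, ← sum_inner,
    sum_sub_mean hn, inner_zero_left]
  simp

/-- The cross terms vanish: independent centered vectors are orthogonal on average. -/
theorem sum_norm_sum_sq {n : ℕ} (z : Fin n → E) (hz : ∑ i, z i = 0) (m : ℕ) :
    (∑ f : Fin m → Fin n, ‖∑ s, z (f s)‖ ^ 2) * n = m * (n : ℝ) ^ m * ∑ i, ‖z i‖ ^ 2 := by
  induction m with
  | zero => simp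
  | succ m ih =>
    have h : ∑ f : Fin (m + 1) → Fin n, ‖∑ s, z (f s)‖ ^ 2 =
        ∑ f : Fin m → Fin n, ∑ a, ‖z a + ∑ s, z (f s)‖ ^ 2 := by
      rw [← (Fin.consEquiv fun _ => Fin n).sum_comp, Fintype.sum_prod_type_right]
      simp [Fin.sum_univ_succ, Fin.consEquiv]
    have h' : ∀ f : Fin m → Fin n, ∑ a, ‖z a + ∑ s, z (f s)‖ ^ 2 =
        ∑ a, ‖z a‖ ^ 2 + n * ‖∑ s, z (f s)‖ ^ 2 := by
      intro f
      simp only [norm_add_sq_real, Finset.sum_add_distrib, ← Finset.mul_sum, ← sum_inner, hz,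
        inner_zero_left]
      simp
    rw [h, Finset.sum_congr rfl fun f _ => h' f, Finset.sum_add_distrib, ← Finset.mul_sum,
      mul_comm (n : ℝ) (∑ f : Fin m → Fin n, _), ih]
    simp only [Finset.sum_const, Finset.card_univ, Fintype.card_pi, Fintype.card_fin,
      Finset.prod_const, nsmul_eq_mul]
    push_cast
    ring

/-- The mean of `m` independent uniform samples has expected squared distance
`(1 / m) * (1 / n) * ∑ i, ‖y i - mean y‖ ^ 2` from the mean of all points. -/
theorem sum_norm_mean_sample_sub_sq {n m : ℕ} (hn : 1 ≤ n) (hm : 1 ≤ m) (y : Fin n → E) :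
    (∑ f : Fin m → Fin n, n * ‖mean (fun s => y (f s)) - mean y‖ ^ 2) * m =
      (n : ℝ) ^ m * ∑ i, ‖y i - mean y‖ ^ 2 := by
  have hm' : (m : ℝ) ≠ 0 := by positivity
  have h := sum_norm_sum_sq (fun i => y i - mean y) (sum_sub_mean hn y) m
  have h' : ∀ f : Fin m → Fin n, ‖mean (fun s => y (f s)) - mean y‖ ^ 2 =
      (m : ℝ)⁻¹ ^ 2 * ‖∑ s, (y (f s) - mean y)‖ ^ 2 := by
    intro f
    have : mean (fun s => y (f s)) - mean y = (m : ℝ)⁻¹ • ∑ s, (y (f s) - mean y) := by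
      rw [Finset.sum_sub_distrib, smul_sub, Finset.sum_const, Finset.card_univ, Fintype.card_fin,
        ← Nat.cast_smul_eq_nsmul ℝ, smul_smul, inv_mul_cancel₀ hm', one_smul]
      rfl
    rw [this, norm_smul, mul_pow, Real.norm_eq_abs, sq_abs]
  simp only [h', ← Finset.mul_sum]
  calc _ = (m : ℝ)⁻¹ ^ 2 * m *
        ((∑ f : Fin m → Fin n, ‖∑ s, (y (f s) - mean y)‖ ^ 2) * n) := by ring
    _ = _ := by rw [h]; field_simp

end

/-- The average over all functions `φ` of a quantity that depends only on `φ j`. -/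
theorem sum_apply_mul_card {ι α : Type*} [Fintype ι] [DecidableEq ι] [Fintype α] (j : ι)
    (h : α → ℝ) : (∑ φ : ι → α, h (φ j)) * Fintype.card α =
      Fintype.card (ι → α) * ∑ a, h a := by
  rw [← (Equiv.funSplitAt j α).symm.sum_comp, Fintype.sum_prod_type,
    Fintype.card_congr (Equiv.funSplitAt j α), Fintype.card_prod]
  simp [Equiv.funSplitAt, Equiv.piSplitAt, ← Finset.mul_sum]
  ring

/-- Markov's inequality for the uniform distribution, at twice the mean. -/
theorem card_le_two_mul_card_le {F : Type*} [Fintype F] (f : F → ℝ) (hf : ∀ x, 0 ≤ f x) {a : ℝ}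
    (h : 2 * ∑ x, f x ≤ Fintype.card F * a) :
    (Fintype.card F : ℝ) ≤ 2 * (Finset.univ.filter fun x => f x ≤ a).card := by
  by_contra! hlt
  set good := Finset.univ.filter fun x => f x ≤ a with hgood
  set bad := Finset.univ.filter fun x => ¬ f x ≤ a with hbad
  have hcard : (good.card : ℝ) + bad.card = Fintype.card F := by
    exact_mod_cast Finset.card_filter_add_card_filter_not (s := Finset.univ) (fun x => f x ≤ a)
  have hbad0 : 0 < bad.card := by
    have : (0 : ℝ) < bad.card := by
      have : (0 : ℝ) ≤ good.card := by positivity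
      linarith
    exact_mod_cast this
  have h1 : (bad.card : ℝ) * a < ∑ x ∈ bad, f x := by
    rw [← nsmul_eq_mul, ← Finset.sum_const]
    exact Finset.sum_lt_sum_of_nonempty (Finset.card_pos.1 hbad0) fun x hx =>
      not_le.1 (Finset.mem_filter.1 hx).2
  have h2 : ∑ x ∈ bad, f x ≤ ∑ x, f x :=
    Finset.sum_le_sum_of_subset_of_nonneg (Finset.filter_subset _ _) fun x _ _ => hf x
  have ha : 0 ≤ a := by
    by_contra! ha
    have hF : (0 : ℝ) < Fintype.card F := by
      have : (0 : ℝ) < bad.card := by exact_mod_cast hbad0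
      have : (0 : ℝ) ≤ good.card := by positivity
      linarith
    have : 0 ≤ ∑ x, f x := Finset.sum_nonneg fun x _ => hf x
    nlinarith
  nlinarith

/-! ### Chromatic partitions as permutations -/

section

variable {n d k : ℕ}

/-- The total squared distance of the points to their centers, if point `l` of point-set `i`
belongs to the center `σ i l`. -/
noncomputable def assignCost (G : FullPointSets n d k) (C : Fin k → EuclideanSpace ℝ (Fin d))
    (σ : Fin n → Equiv.Perm (Fin k)) : ℝ :=
  ∑ i, ∑ l, ‖G i l - C (σ i l)‖ ^ 2

/-- The point of the point-set `i` in cluster `j`. -/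
def clusterPoint (G : FullPointSets n d k) (σ : Fin n → Equiv.Perm (Fin k)) (j : Fin k)
    (i : Fin n) : EuclideanSpace ℝ (Fin d) :=
  G i ((σ i).symm j)

theorem assignCost_eq (G : FullPointSets n d k) (C : Fin k → EuclideanSpace ℝ (Fin d))
    (σ : Fin n → Equiv.Perm (Fin k)) :
    assignCost G C σ = ∑ j, ∑ i, ‖clusterPoint G σ j i - C j‖ ^ 2 := by
  rw [assignCost, Finset.sum_comm (s := (Finset.univ : Finset (Fin k)))]
  refine Finset.sum_congr rfl fun i _ => ?_
  rw [← Equiv.sum_comp (σ i) fun j => ‖clusterPoint G σ j i - C j‖ ^ 2]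
  simp [clusterPoint]

/-- The least cost with the given clusters, which is attained at their means. -/
noncomputable def meanCost (G : FullPointSets n d k) (σ : Fin n → Equiv.Perm (Fin k)) : ℝ :=
  ∑ j, ∑ i, ‖clusterPoint G σ j i - mean (clusterPoint G σ j)‖ ^ 2

theorem assignCost_eq_meanCost_add (hn : 1 ≤ n) (G : FullPointSets n d k)
    (C : Fin k → EuclideanSpace ℝ (Fin d)) (σ : Fin n → Equiv.Perm (Fin k)) :
    assignCost G C σ = meanCost G σ + ∑ j, n * ‖C j - mean (clusterPoint G σ j)‖ ^ 2 := by
  rw [assignCost_eq, meanCost, ← Finset.sum_add_distrib]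
  exact Finset.sum_congr rfl fun j _ => sum_norm_sub_sq hn _ _

theorem meanCost_le_assignCost (hn : 1 ≤ n) (G : FullPointSets n d k)
    (C : Fin k → EuclideanSpace ℝ (Fin d)) (σ : Fin n → Equiv.Perm (Fin k)) :
    meanCost G σ ≤ assignCost G C σ := by
  rw [assignCost_eq_meanCost_add hn]
  exact le_add_of_nonneg_right (Finset.sum_nonneg fun j _ => by positivity)

theorem meanCost_nonneg (G : FullPointSets n d k) (σ : Fin n → Equiv.Perm (Fin k)) :
    0 ≤ meanCost G σ :=
  Finset.sum_nonneg fun j _ => Finset.sum_nonneg fun i _ => by positivity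

theorem isChromaticPartition_of_perm {U : Fin k → Finset (Σ _ : Fin n, Fin k)}
    {σ : Fin n → Equiv.Perm (Fin k)} (h : ∀ i l j, (⟨i, l⟩ : Σ _ : Fin n, Fin k) ∈ U j ↔ σ i l = j) :
    IsChromaticPartition (K := fun _ => k) U := by
  refine ⟨fun ⟨i, l⟩ => ⟨σ i l, (h i l _).2 rfl, fun j hj => ((h i l j).1 hj).symm⟩, ?_⟩
  rintro j ⟨i, l⟩ hq ⟨i', l'⟩ hq' (rfl : i = i')
  rw [h] at hq hq'
  rw [(σ i).injective (hq.trans hq'.symm)]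

theorem cost_eq_assignCost {U : Fin k → Finset (Σ _ : Fin n, Fin k)}
    {σ : Fin n → Equiv.Perm (Fin k)} (h : ∀ i l j, (⟨i, l⟩ : Σ _ : Fin n, Fin k) ∈ U j ↔ σ i l = j)
    (G : FullPointSets n d k) (C : Fin k → EuclideanSpace ℝ (Fin d)) :
    cost G C U = 1 / (n : ℝ) * assignCost G C σ := by
  rw [cost, assignCost]
  congr 1
  have hU : ∀ j, ∑ q ∈ U j, ‖G q.1 q.2 - C j‖ ^ 2 =
      ∑ i, ∑ l, if σ i l = j then ‖G i l - C j‖ ^ 2 else 0 := by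
    intro j
    rw [← Fintype.sum_sigma' (fun i l => if σ i l = j then ‖G i l - C j‖ ^ 2 else 0),
      ← Finset.sum_filter]
    refine Finset.sum_congr ?_ fun _ _ => rfl
    ext ⟨i, l⟩
    simp [h]
  simp only [hU]
  rw [Finset.sum_comm]
  refine Finset.sum_congr rfl fun i _ => ?_
  rw [Finset.sum_comm]
  simp

/-- As every set of the partition contains at most one of the `k` points of a point-set, and there
are `k` sets, it contains exactly one. -/
theorem IsChromaticPartition.exists_perm {U : Fin k → Finset (Σ _ : Fin n, Fin k)}
    (hU : IsChromaticPartition (K := fun _ => k) U) : ∃ σ : Fin n → Equiv.Perm (Fin k),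
      ∀ i l j, (⟨i, l⟩ : Σ _ : Fin n, Fin k) ∈ U j ↔ σ i l = j := by
  choose κ hκ huniq using hU.1
  have hinj : ∀ i, Function.Injective fun l : Fin k => κ ⟨i, l⟩ := by
    intro i l l' hll
    have h := hU.2 (κ ⟨i, l⟩) ⟨i, l⟩ (hκ _) ⟨i, l'⟩ (by
      have := hκ ⟨i, l'⟩
      rwa [← show κ ⟨i, l⟩ = κ ⟨i, l'⟩ from hll] at this) rfl
    simpa using h
  refine ⟨fun i => Equiv.ofBijective _ (Finite.injective_iff_bijective.1 (hinj i)),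
    fun i l j => ⟨fun h => (huniq _ _ h).symm, ?_⟩⟩
  rintro rfl
  exact hκ _

/-! ### The success probability of the trials -/

/-- The point with number `q`, where the points are numbered as in the input. -/
def numberedPoint (G : FullPointSets n d k) (q : Fin (n * k)) : EuclideanSpace ℝ (Fin d) :=
  G (finProdFinEquiv.symm q).1 (finProdFinEquiv.symm q).2

theorem numberedPoint_apply (G : FullPointSets n d k) (i : Fin n) (l : Fin k) :
    numberedPoint G (finProdFinEquiv (i, l)) = G i l := by
  have h := Equiv.symm_apply_apply finProdFinEquiv (i, l)
  rw [numberedPoint, h]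

/-- The centers of a trial: the means of the sampled points. -/
noncomputable def sampleCenters {m : ℕ} (G : FullPointSets n d k)
    (Φ : Fin k → Fin m → Fin (n * k)) (j : Fin k) : EuclideanSpace ℝ (Fin d) :=
  mean fun s => numberedPoint G (Φ j s)

/-- If all samples come from the right clusters, then the expected cost of the means of the samples
is `1 + 1 / m` times the cost of the means of the clusters, so that at least half of these samples
are good. A sampled point-set comes with a point of the right cluster with probability `1 / k`. -/
theorem card_le_mul_card_good {m : ℕ} {ε : ℝ} (hn : 1 ≤ n) (hm : 1 ≤ m) (hmε : 2 ≤ m * ε)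
    (G : FullPointSets n d k) (σ : Fin n → Equiv.Perm (Fin k)) :
    (Fintype.card (Fin k → Fin m → Fin (n * k)) : ℝ) ≤ 2 * (k : ℝ) ^ (m * k) *
      (Finset.univ.filter fun Φ : Fin k → Fin m → Fin (n * k) =>
        assignCost G (sampleCenters G Φ) σ ≤ (1 + ε) * meanCost G σ).card := by
  classical
  have hm0 : (0 : ℝ) < m := by exact_mod_cast hm
  -- a sample of point-sets together with the points that lie in the right clusters
  set lift : (Fin k → Fin m → Fin n) → (Fin k → Fin m → Fin (n * k)) :=
    fun φ j s => finProdFinEquiv (φ j s, (σ (φ j s)).symm j) with hlift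
  have hlift_inj : Function.Injective lift := by
    intro φ φ' h
    funext j s
    have := congrFun (congrFun h j) s
    simp only [hlift, EmbeddingLike.apply_eq_iff_eq, Prod.mk.injEq] at this
    exact this.1
  have hcenters : ∀ φ j, sampleCenters G (lift φ) j =
      mean fun s => clusterPoint G σ j (φ j s) := by
    intro φ j
    simp only [sampleCenters, hlift, numberedPoint_apply, clusterPoint]
  set excess : (Fin k → Fin m → Fin n) → ℝ := fun φ =>
    ∑ j, n * ‖mean (fun s => clusterPoint G σ j (φ j s)) - mean (clusterPoint G σ j)‖ ^ 2
    with hexcess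
  -- the expected excess of the cost
  have hsum : (∑ φ, excess φ) * m = Fintype.card (Fin k → Fin m → Fin n) * meanCost G σ := by
    rw [hexcess, Finset.sum_comm, Finset.sum_mul, meanCost, Finset.mul_sum]
    refine Finset.sum_congr rfl fun j _ => ?_
    have h1 := sum_apply_mul_card (ι := Fin k) (α := Fin m → Fin n) j (fun f => (n : ℝ) *
      ‖mean (fun s => clusterPoint G σ j (f s)) - mean (clusterPoint G σ j)‖ ^ 2)
    have h2 := sum_norm_mean_sample_sub_sq hn hm (clusterPoint G σ j)
    have hcard : (Fintype.card (Fin m → Fin n) : ℝ) = (n : ℝ) ^ m := by simp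
    have hpos : (0 : ℝ) < (n : ℝ) ^ m := by positivity
    rw [hcard] at h1
    refine mul_left_cancel₀ hpos.ne' ?_
    linear_combination (m : ℝ) * h1 + (Fintype.card (Fin k → Fin m → Fin n) : ℝ) * h2
  have hmarkov := card_le_two_mul_card_le excess
    (fun φ => Finset.sum_nonneg fun j _ => by positivity) (a := ε * meanCost G σ) (by
      have hV := meanCost_nonneg G σ
      have hc : (0 : ℝ) ≤ Fintype.card (Fin k → Fin m → Fin n) * meanCost G σ := by positivity
      refine le_of_mul_le_mul_right ?_ hm0
      nlinarith)
  have hle : (Finset.univ.filter fun φ => excess φ ≤ ε * meanCost G σ).card ≤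
      (Finset.univ.filter fun Φ : Fin k → Fin m → Fin (n * k) =>
        assignCost G (sampleCenters G Φ) σ ≤ (1 + ε) * meanCost G σ).card := by
    refine Finset.card_le_card_of_injOn lift (fun φ hφ => ?_) hlift_inj.injOn
    simp only [Finset.coe_filter, Finset.mem_univ, true_and, Set.mem_ofPred_eq] at hφ ⊢
    rw [assignCost_eq_meanCost_add hn]
    simp only [hcenters]
    simp only [hexcess] at hφ
    linarith
  have hle' : ((Finset.univ.filter fun φ => excess φ ≤ ε * meanCost G σ).card : ℝ) ≤
      (Finset.univ.filter fun Φ : Fin k → Fin m → Fin (n * k) =>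
        assignCost G (sampleCenters G Φ) σ ≤ (1 + ε) * meanCost G σ).card := by
    exact_mod_cast hle
  have hcards : (Fintype.card (Fin k → Fin m → Fin (n * k)) : ℝ) =
      (k : ℝ) ^ (m * k) * Fintype.card (Fin k → Fin m → Fin n) := by
    simp only [Fintype.card_pi, Fintype.card_fin, Finset.prod_const, Finset.card_univ]
    push_cast
    rw [mul_pow, mul_pow, pow_mul, mul_comm]
  rw [hcards]
  have hk0 : (0 : ℝ) ≤ (k : ℝ) ^ (m * k) := by positivity
  nlinarith [mul_le_mul_of_nonneg_left (hmarkov.trans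
    (mul_le_mul_of_nonneg_left hle' (by norm_num : (0 : ℝ) ≤ 2))) hk0]

/-- With `R` independent trials, each of which succeeds with probability at least `1 / (2 * R)`, the
probability that all fail is at most `(1 - 1 / (2 * R)) ^ R ≤ 2 / 3`. -/
theorem card_le_three_mul_card_exists {F : Type*} [Fintype F] [Nonempty F] {R : ℕ} (hR : 1 ≤ R)
    (good : F → Prop) [DecidablePred good]
    (h : (Fintype.card F : ℝ) ≤ 2 * R * (Finset.univ.filter good).card) :
    (Fintype.card (Fin R → F) : ℝ) ≤
      3 * (Finset.univ.filter fun Ψ : Fin R → F => ∃ t, good (Ψ t)).card := by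
  classical
  have hR0 : (0 : ℝ) < R := by exact_mod_cast hR
  have hF : (0 : ℝ) < Fintype.card F := by exact_mod_cast Fintype.card_pos
  set a : ℝ := (Fintype.card F : ℝ)
  set b : ℝ := ((Finset.univ.filter fun x => ¬ good x).card : ℝ) with hb
  have hab : b + (Finset.univ.filter good).card = a := by
    have h0 := Finset.card_filter_add_card_filter_not (s := (Finset.univ : Finset F)) good
    rw [Finset.card_univ] at h0
    rw [add_comm, hb]
    change _ = (Fintype.card F : ℝ)
    exact_mod_cast h0
  have hall : (Finset.univ.filter fun Ψ : Fin R → F => ¬ ∃ t, good (Ψ t)).card =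
      (Finset.univ.filter fun x => ¬ good x).card ^ R := by
    rw [← Fintype.card_piFinset_const]
    congr 1
    ext Ψ
    simp
  have hsplit : (Fintype.card (Fin R → F) : ℝ) =
      (Finset.univ.filter fun Ψ : Fin R → F => ∃ t, good (Ψ t)).card + b ^ R := by
    rw [hb, ← Nat.cast_pow, ← hall]
    exact_mod_cast (Finset.card_filter_add_card_filter_not
      (s := (Finset.univ : Finset (Fin R → F))) fun Ψ => ∃ t, good (Ψ t)).symm
  have hcard : (Fintype.card (Fin R → F) : ℝ) = a ^ R := by simp [a]
  -- `x` is a lower bound for the success probability of a trial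
  set x : ℝ := 1 / (2 * R) with hx
  have hx0 : 0 ≤ x := by positivity
  have hRx : R * x = 1 / 2 := by rw [hx]; field_simp
  have hx1 : x ≤ 1 := by
    rw [hx, div_le_one (by positivity)]
    have : (1 : ℝ) ≤ R := by exact_mod_cast hR
    linarith
  have hbx : b ≤ a * (1 - x) := by
    have : a * x ≤ (Finset.univ.filter good).card := by
      rw [hx, mul_one_div, div_le_iff₀ (by positivity)]
      linarith
    linarith
  have hpow : (1 - x) ^ R * (3 / 2) ≤ 1 := by
    have h1 : (3 / 2 : ℝ) ≤ (1 + x) ^ R := by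
      have := one_add_mul_le_pow (a := x) (by linarith) R
      linarith
    calc (1 - x) ^ R * (3 / 2) ≤ (1 - x) ^ R * (1 + x) ^ R := by
          gcongr
      _ = (1 - x ^ 2) ^ R := by rw [← mul_pow]; congr 1; ring
      _ ≤ 1 := pow_le_one₀ (by nlinarith) (by nlinarith)
  have hbR : b ^ R ≤ a ^ R * (1 - x) ^ R := by
    rw [← mul_pow]
    exact pow_le_pow_left₀ (by positivity) hbx R
  have haR : 0 < a ^ R := by positivity
  have : b ^ R ≤ 2 / 3 * a ^ R := by nlinarith
  rw [hcard] at hsplit ⊢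
  linarith

end

/-! ### The output is an approximation -/

section

variable {n d k m R : ℕ}

theorem inputMemory_point (ε : ℝ) (G : FullPointSets n d k) (q : Fin (n * k)) (c : Fin d) :
    (inputMemory ε G).real 1 (q * d + c) = numberedPoint G q c := by
  have hval : (q * d + c : ℕ) = (finProdFinEquiv (q, c) : Fin (n * k * d)) := by
    simp only [finProdFinEquiv_apply_val]; ring
  have hlt : (q * d + c : ℕ) < n * k * d := by rw [hval]; exact Fin.is_lt _
  have hfin : (⟨q * d + c, hlt⟩ : Fin (n * k * d)) = finProdFinEquiv (q, c) := Fin.ext hval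
  simp only [inputMemory, one_ne_zero, if_false, if_true, dif_pos hlt, numberedPoint]
  rw [hfin, Equiv.symm_apply_apply]

/-- The samples of all trials, read off from the random tape. -/
def tapeEquiv (R k m M : ℕ) :
    (Fin (R * k * m) → Fin M) ≃ (Fin R → Fin k → Fin m → Fin M) :=
  (Equiv.arrowCongr ((finProdFinEquiv.prodCongr (Equiv.refl (Fin m))).trans finProdFinEquiv).symm
    (Equiv.refl (Fin M))).trans ((Equiv.curry _ _ _).trans (Equiv.curry _ _ _))

theorem tapeEquiv_apply {M : ℕ} (ω : Fin (R * k * m) → Fin M) (t : Fin R) (j : Fin k) (i : Fin m) :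
    tapeEquiv R k m M ω t j i = ω (finProdFinEquiv (finProdFinEquiv (t, j), i)) := rfl

theorem trialCenter_eq (ε : ℝ) (G : FullPointSets n d k) (w : ℕ → ℕ)
    (ω : Fin (R * k * m) → Fin (n * k)) (t : Fin R) (j : Fin k) (c : Fin d) :
    trialCenter d k m ((inputMemory ε G).real 1) (overwrite w ω) t j c =
      sampleCenters G (tapeEquiv R k m (n * k) ω t) j c := by
  have hω : ∀ i : Fin m, overwrite w ω ((t * k + j) * m + i) = tapeEquiv R k m (n * k) ω t j i := by
    intro i
    have hval : ((t * k + j) * m + i : ℕ) =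
        (finProdFinEquiv (finProdFinEquiv (t, j), i) : Fin (R * k * m)) := by
      simp only [finProdFinEquiv_apply_val]; ring
    have hlt : ((t * k + j) * m + i : ℕ) < R * k * m := by rw [hval]; exact Fin.is_lt _
    have hfin : (⟨_, hlt⟩ : Fin (R * k * m)) = finProdFinEquiv (finProdFinEquiv (t, j), i) :=
      Fin.ext hval
    rw [overwrite, dif_pos hlt, tapeEquiv_apply, hfin]
  rw [trialCenter, Finset.sum_range]
  simp only [hω, inputMemory_point, sampleCenters, mean, PiLp.smul_apply, WithLp.ofLp_sum,
    Finset.sum_apply, smul_eq_mul]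
  rw [div_eq_inv_mul]

theorem weight_eq (ε : ℝ) (G : FullPointSets n d k) {ctr : ℕ → ℕ → ℝ}
    {C : Fin k → EuclideanSpace ℝ (Fin d)} (h : ∀ (j : Fin k) (c : Fin d), ctr j c = C j c)
    (i : Fin n) (l j : Fin k) :
    weight d k ((inputMemory ε G).real 1) ctr i l j = ‖G i l - C j‖ ^ 2 := by
  have hil : (i * k + l : ℕ) = (finProdFinEquiv (i, l) : Fin (n * k)) := by
    simp only [finProdFinEquiv_apply_val]; ring
  rw [weight, EuclideanSpace.real_norm_sq_eq, Finset.sum_range]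
  refine Finset.sum_congr rfl fun c _ => ?_
  rw [hil, inputMemory_point, numberedPoint_apply, h]
  rfl

theorem sum_weight_eq (ε : ℝ) (G : FullPointSets n d k) {ctr : ℕ → ℕ → ℝ}
    {C : Fin k → EuclideanSpace ℝ (Fin d)} (h : ∀ (j : Fin k) (c : Fin d), ctr j c = C j c)
    {f : ℕ → ℕ → ℕ} {σ : Fin n → Equiv.Perm (Fin k)}
    (hf : ∀ (i : Fin n) (l : Fin k), f i l = σ i l) :
    ∑ i ∈ Finset.range n, ∑ l ∈ Finset.range k,
      weight d k ((inputMemory ε G).real 1) ctr i l (f i l) = assignCost G C σ := by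
  rw [Finset.sum_range, assignCost]
  refine Finset.sum_congr rfl fun i _ => ?_
  rw [Finset.sum_range]
  refine Finset.sum_congr rfl fun l _ => ?_
  rw [hf, weight_eq ε G h]

theorem IsPerm.exists_perm {f : ℕ → ℕ} (hf : IsPerm k f) :
    ∃ σ : Equiv.Perm (Fin k), ∀ l : Fin k, f l = σ l := by
  have hinj : Function.Injective fun l : Fin k => (⟨f l, hf.1 l l.2⟩ : Fin k) := by
    intro a b hab
    have hab' : f a = f b := congrArg Fin.val hab
    rcases lt_trichotomy a b with h | h | h
    · exact absurd hab'.symm (hf.2 b b.2 a h)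
    · exact h
    · exact absurd hab' (hf.2 a a.2 b h)
  exact ⟨Equiv.ofBijective _ (Finite.injective_iff_bijective.1 hinj), fun l => rfl⟩

/-- If some trial is good for an optimal solution `σ`, then the best trial is an approximation. -/
theorem isApproximation_of_isBestTrial {ε : ℝ} (hε : 0 < ε) (hn : 1 ≤ n)
    (G : FullPointSets n d k) {w : ℕ → ℕ} {ω : Fin (R * k * m) → Fin (n * k)} {s : Memory}
    (hs : IsBestTrial n d k m R ((inputMemory ε G).real 1) (overwrite w ω) s)
    {σ : Fin n → Equiv.Perm (Fin k)} (hσ : ∀ τ, meanCost G σ ≤ meanCost G τ)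
    (hgood : ∃ t, assignCost G (sampleCenters G (tapeEquiv R k m (n * k) ω t)) σ ≤
      (1 + ε) * meanCost G σ) :
    IsApproximation (1 + ε) G (outputCenters d k s) (outputClusters n k s) := by
  obtain ⟨t, ht, f, hf, hctr, hcl, hbest⟩ := hs
  obtain ⟨t', ht'⟩ := hgood
  choose τ hτ using fun i : Fin n => (hf i i.2).exists_perm
  have hout : ∀ i l j, (⟨i, l⟩ : Σ _ : Fin n, Fin k) ∈ outputClusters n k s j ↔ τ i l = j := by
    intro i l j
    rw [outputClusters, Finset.mem_filter, hcl i i.2 l l.2, hτ, Fin.val_inj]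
    simp
  have hcenters : outputCenters d k s =
      sampleCenters G (tapeEquiv R k m (n * k) ω ⟨t, ht⟩) := by
    funext j
    ext c
    rw [← trialCenter_eq ε G w ω ⟨t, ht⟩ j c]
    exact hctr j j.2 c c.2
  refine ⟨isChromaticPartition_of_perm hout, fun C' U' hU' => ?_⟩
  obtain ⟨τ', hτ'⟩ := hU'.exists_perm
  rw [cost_eq_assignCost hout, cost_eq_assignCost hτ', hcenters, mul_left_comm]
  refine mul_le_mul_of_nonneg_left ?_ (by positivity)
  -- the good trial competes with the assignments `σ`; the value `0` out of range is irrelevant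
  have h := hbest t' t'.2 (fun i l => if h : i < n ∧ l < k then σ ⟨i, h.1⟩ ⟨l, h.2⟩ else 0)
    (fun i hi => ⟨fun l hl => by simp [hi, hl], fun a ha b hb => by
      simp only [hi, ha, hb.trans ha, and_self, dif_pos, ne_eq, Fin.val_inj,
        EmbeddingLike.apply_eq_iff_eq, Fin.mk.injEq]
      exact hb.ne'⟩)
  rw [sum_weight_eq ε G (trialCenter_eq ε G w ω ⟨t, ht⟩) hτ,
    sum_weight_eq ε G (trialCenter_eq ε G w ω t') (σ := σ) (fun i l => by simp)] at h
  calc _ ≤ _ := h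
    _ ≤ (1 + ε) * meanCost G σ := ht'
    _ ≤ (1 + ε) * assignCost G C' τ' := by
      have := (hσ τ').trans (meanCost_le_assignCost hn G C' τ')
      gcongr

/-- At least a third of the random tapes contain a good trial. -/
theorem third_le_measure_exists_good {ε : ℝ} (hn : 1 ≤ n) (hm : 1 ≤ m)
    (hmε : 2 ≤ m * ε) (hR : R = 2 ^ (k * k * m)) [NeZero (n * k)] (G : FullPointSets n d k)
    (σ : Fin n → Equiv.Perm (Fin k)) :
    ENNReal.ofReal (1 / 3) ≤
      (PMF.uniformOfFintype (Fin (R * k * m) → Fin (n * k))).toOuterMeasure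
        {ω | ∃ t, assignCost G (sampleCenters G (tapeEquiv R k m (n * k) ω t)) σ ≤
          (1 + ε) * meanCost G σ} := by
  classical
  have hR1 : 1 ≤ R := by rw [hR]; exact Nat.one_le_two_pow
  have hkR : (k : ℝ) ^ (m * k) ≤ R := by
    have : k ^ (m * k) ≤ R := by
      calc k ^ (m * k) ≤ (2 ^ k) ^ (m * k) := Nat.pow_le_pow_left Nat.lt_two_pow_self.le _
        _ = R := by rw [hR, ← pow_mul]; congr 1; ring
    exact_mod_cast this
  have h1 := card_le_mul_card_good hn hm hmε G σ
  have h2 := card_le_three_mul_card_exists hR1 (fun Φ : Fin k → Fin m → Fin (n * k) =>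
    assignCost G (sampleCenters G Φ) σ ≤ (1 + ε) * meanCost G σ) (h1.trans (by gcongr))
  rw [← Fintype.card_congr (tapeEquiv R k m (n * k))] at h2
  rw [PMF.toOuterMeasure_uniformOfFintype_apply]
  have hcard : (Finset.univ.filter fun Ψ : Fin R → Fin k → Fin m → Fin (n * k) =>
      ∃ t, assignCost G (sampleCenters G (Ψ t)) σ ≤ (1 + ε) * meanCost G σ).card =
      Fintype.card {ω : Fin (R * k * m) → Fin (n * k) |
        ∃ t, assignCost G (sampleCenters G (tapeEquiv R k m (n * k) ω t)) σ ≤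
          (1 + ε) * meanCost G σ} := by
    rw [← Fintype.card_subtype]
    exact (Fintype.card_congr ((tapeEquiv R k m (n * k)).subtypeEquiv fun ω => Iff.rfl)).symm
  rw [hcard] at h2
  have hpos : (0 : ℝ) < Fintype.card (Fin (R * k * m) → Fin (n * k)) := by
    exact_mod_cast Fintype.card_pos
  rw [← ENNReal.ofReal_natCast (Fintype.card (Fin (R * k * m) → Fin (n * k))),
    ← ENNReal.ofReal_natCast, ← ENNReal.ofReal_div_of_pos hpos]
  refine ENNReal.ofReal_le_ofReal ?_
  rw [div_le_div_iff₀ (by norm_num) hpos]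
  linarith

/-- As `m ≤ 3 / ε` and `R = 2 ^ (k * k * m)`, the part of the running time that does not depend on
`n` and `d` is, up to a constant factor, at most `R ^ 3 ≤ 2 ^ (9 * (k / ε) ^ 3)`. -/
theorem time_le {ε : ℝ} (hk : 1 ≤ k) (hε : 0 < ε) (hε1 : ε ≤ 1)
    (hm : m = ⌈2 / ε⌉₊) (hR : R = 2 ^ (k * k * m)) :
    200000000000 * (R * (n * (R * (k * (k * (d * m)))))) ≤
      ⌊(200000000000 : ℝ) * (2 : ℝ) ^ ((9 * Polynomial.X ^ 3 : Polynomial ℝ).eval ((k : ℝ) / ε)) *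
        (n : ℝ) * (d : ℝ)⌋₊ := by
  have hk1 : (1 : ℝ) ≤ k := by exact_mod_cast hk
  have hle : k * k * m ≤ R := by rw [hR]; exact Nat.lt_two_pow_self.le
  have hr : (k : ℝ) ≤ k / ε := by rw [le_div_iff₀ hε]; nlinarith
  have hm3 : (m : ℝ) ≤ 3 * (k / ε) := by
    have h1 : (m : ℝ) < 2 / ε + 1 := by rw [hm]; exact Nat.ceil_lt_add_one (by positivity)
    have h2 : 1 / ε ≤ k / ε := by gcongr
    have h3 : 1 ≤ 1 / ε := by rw [le_div_iff₀ hε]; linarith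
    have h4 : 2 / ε = 2 * (1 / ε) := by ring
    linarith
  have hexp : ((3 * (k * k * m) : ℕ) : ℝ) ≤ 9 * (k / ε : ℝ) ^ 3 := by
    push_cast
    calc (3 * (k * k * m) : ℝ) ≤ 3 * ((k / ε) * (k / ε) * (3 * (k / ε))) := by gcongr
      _ = _ := by ring
  have hpow : (R : ℝ) ^ 3 ≤ (2 : ℝ) ^ (9 * (k / ε : ℝ) ^ 3) := by
    calc (R : ℝ) ^ 3 = (2 : ℝ) ^ ((3 * (k * k * m) : ℕ) : ℝ) := by
          rw [Real.rpow_natCast, hR]; push_cast; rw [← pow_mul]; congr 1; ring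
      _ ≤ _ := Real.rpow_le_rpow_of_exponent_le (by norm_num) hexp
  refine Nat.le_floor ?_
  have h1 : 200000000000 * (R * (n * (R * (k * (k * (d * m)))))) ≤
      200000000000 * R ^ 3 * n * d := by
    calc 200000000000 * (R * (n * (R * (k * (k * (d * m)))))) =
        200000000000 * (R * R * (k * k * m)) * n * d := by ring
      _ ≤ 200000000000 * (R * R * R) * n * d := by gcongr
      _ = _ := by ring
  calc ((200000000000 * (R * (n * (R * (k * (k * (d * m)))))) : ℕ) : ℝ) ≤
        ((200000000000 * R ^ 3 * n * d : ℕ) : ℝ) := by exact_mod_cast h1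
    _ = 200000000000 * (R : ℝ) ^ 3 * n * d := by push_cast; ring
    _ ≤ _ := by
      simp only [Polynomial.eval_mul, Polynomial.eval_pow, Polynomial.eval_X,
        Polynomial.eval_ofNat]
      gcongr

end

end ChromaticClustering

theorem mainTheorem6 :
    ∃ (A : RealRAM.Program) (c C : ℝ) (p : Polynomial ℝ), 0 < c ∧ 0 < C ∧
      ∀ (n d k : ℕ) (ε : ℝ), 1 ≤ n → 1 ≤ d → 1 ≤ k → 0 < ε → ε ≤ 1 →
      ∀ (G : ChromaticClustering.FullPointSets n d k) (T : ℕ),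
        T = ⌊C * (2 : ℝ) ^ (p.eval ((k : ℝ) / ε)) * (n : ℝ) * (d : ℝ)⌋₊ →
        RealRAM.HaltsWithin A (ChromaticClustering.inputMemory ε G) T ∧
        ENNReal.ofReal c ≤
          (RealRAM.run A (ChromaticClustering.inputMemory ε G) T).toOuterMeasure
            {x | ChromaticClustering.IsApproximation (1 + ε) G
              (ChromaticClustering.outputCenters d k x.mem)
              (ChromaticClustering.outputClusters n k x.mem)} := by
  refine ⟨ChromaticClustering.mainProg, 1 / 3, 200000000000, 9 * Polynomial.X ^ 3, by norm_num,
    by norm_num, ?_⟩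
  intro n d k ε hn hd hk hε hε1 G T hT
  have : NeZero (n * k) := ⟨(Nat.mul_pos hn hk).ne'⟩
  obtain ⟨m, hm⟩ : ∃ m, m = ⌈2 / ε⌉₊ := ⟨_, rfl⟩
  obtain ⟨R, hR⟩ : ∃ R, R = 2 ^ (k * k * m) := ⟨_, rfl⟩
  have hm1 : 1 ≤ m := by rw [hm]; exact Nat.one_le_ceil_iff.2 (by positivity)
  have hmε : 2 ≤ m * ε := by
    rw [← div_le_iff₀ hε, hm]
    exact Nat.le_ceil _
  obtain ⟨g, hrun, hg⟩ := ChromaticClustering.exists_run_mainProg (d := d) (T := T)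
    (s := ChromaticClustering.inputMemory ε G) hε hn hd hk hm hR
    (by simp [ChromaticClustering.inputMemory]) rfl (by simp [ChromaticClustering.inputMemory]) rfl
    (by rw [hT]; exact ChromaticClustering.time_le hk hε hε1 hm hR)
  obtain ⟨σ, hσ⟩ := Finite.exists_min (ChromaticClustering.meanCost G)
  constructor
  · intro x hx
    rw [hrun, PMF.support_map] at hx
    obtain ⟨ω, -, rfl⟩ := hx
    exact ⟨(hg ω).1, (hg ω).2.1⟩
  · rw [hrun, PMF.toOuterMeasure_map_apply]
    refine (ChromaticClustering.third_le_measure_exists_good hn hm1 hmε hR G σ).trans ?_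
    refine MeasureTheory.measure_mono fun ω hω => ?_
    exact ChromaticClustering.isApproximation_of_isBestTrial hε hn G (hg ω).2.2 hσ hω
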